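/- Let $d\ge 2$. A simplicial partition $\triangle$ of a (closed) polyhedral domain $\Omega\subset\mathbb R^d$ is a finite geometric simplicial complex with union $\Omega$ in which every face is a face of a $d$-simplex; below, "simplex" means $d$-simplex of $\triangle$ (a closed set). Let $|\triangle|$ be the largest diameter of a simplex; $\triangle$ is $\beta$-quasi-uniform if $|\triangle|/\rho_T\le\beta$ for all simplices $T$, where $\rho_T$ is the radius of the inscribed ball. Put $\operatorname{star}^0(T)=\{T\}$ and let $\operatorname{star}^{k+1}(T)$ be the set of all simplices that intersect a simplex of $\operatorname{star}^k(T)$; we also write $\operatorname{star}^k(T)$ for the union of its simplices. A simplex $T$ is $L$ simplices away from the boundary if $L$ is the smallest integer for which there are simplices $T=T_1,\dots,T_{L+1}$ with $T_j\cap T_{j+1}\ne\emptyset$ for $1\le j\le L$ and $T_{L+1}\cap\partial\Omega\ne\emptyset$. For $n\ge1$, $r\ge0$ let $S^r_n(\triangle)$ be the space of $C^r$ functions on $\Omega$ that are polynomials of degree at most $n$ on each simplex, and let $\mathcal W=S^r_n(\triangle)\cap H^1_0(\Omega)$ be the subspace of splines vanishing on $\partial\Omega$, with norm $\|u\|_{\mathcal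 W}=\|\nabla u\|_{L^2(\Omega)}$. A basis $\{B_\xi\}_{\xi\in\mathcal M}$ of $\mathcal W$ is called $1$-local with bound $K_1$ if $\|B_\xi\|_\infty\le K_1$ and $\operatorname{supp}B_\xi\subseteq\operatorname{star}^1(T_\xi)$ for some simplex $T_\xi$, for every $\xi$; it is stable with constants $C_1,C_2>0$ if $$C_1\sum_\xi|c_\xi|^2\le\Big\|\sum_\xi c_\xi B_\xi\Big\|_{\mathcal W}^2\le C_2\sum_\xi|c_\xi|^2\qquad\text{for all }(c_\xi).$$ For a vertex ${\bf v}_i$ of $\triangle$ in the interior of $\Omega$, let $h_i\in S^0_1(\triangle)$ be its hat function, equal to $1$ at ${\bf v}_i$ and to $0$ at all other vertices, let $\widetilde\Omega_i$ be the union of $\operatorname{star}^1(t)$ over all simplices $t\subseteq\operatorname{supp}h_i$, and let the discrete interior GBC function $R_i\in\mathcal W$ be the solution of $$\langle\nabla R_i,\nabla w\rangle=-\langle h_i,w\rangle\qquad\text{for all }w\in\mathcal W .$$ **Theorem.** (a) For every interior vertex ${\bf v}_i$ the hat function $h_i$ and the function $R_i$ exist and are unique. (b) If $r=0$, then $\mathcal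 W$ has a basis that is $1$-local with bound $1$ and stable with some constants $C_1,C_2>0$ (which may depend on $\triangle$ and $n$). (c) For every $\kappa$ there is $\sigma\in(0,1)$, depending only on $\kappa$, and for all $d\ge2$, $r\ge0$, $n\ge1$, $\beta$, $\eta$, $K_1$, and $C_1,C_2>0$ with $C_2/C_1\le\kappa$ there is a constant $K>0$, depending only on $d,r,n,\beta,\eta,K_1,C_1,C_2$ (in addition to $\kappa$), such that the following holds. Let $\triangle$ be a $\beta$-quasi-uniform simplicial partition of a polyhedral domain $\Omega\subset\mathbb R^d$ with $|\triangle|\le\eta$, for which $\mathcal W$ has a $1$-local basis with bound $K_1$ that is stable with constants $C_1,C_2$. Let ${\bf v}_i$ be an interior vertex, let ${\bf v}\in\Omega\setminus\widetilde\Omega_i$, let $T$ be a simplex containing ${\bf v}$, let $k\ge1$ be an integer with $\operatorname{star}^k(T)\subseteq\Omega\setminus\widetilde\Omega_i$, and let $T$ be $L$ simplices away from the boundary. Then $$|R_i({\bf v})|\le K\,(L+1)\,\sigma^k .$$ In particular $K$ and $\sigma$ do not depend on $L$, $k$, ${\bf v}$, $T$, ${\bf v}_i$, the domain, or the number of simplices.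 -/

import Mathlib

open MeasureTheory Set

noncomputable section

namespace GBC

/-- The Euclidean space `ℝᵈ`. -/
abbrev E (d : ℕ) : Type := EuclideanSpace ℝ (Fin d)

/-- A simplicial partition of a polyhedral domain in `ℝᵈ`: a finite geometric simplicial complex
in which every face is a face of a `d`-dimensional simplex. -/
structure SimplicialPartition (d : ℕ) where
  complex : Geometry.SimplicialComplex ℝ (E d)
  finite_faces : complex.faces.Finite
  pure : ∀ s ∈ complex.faces, ∃ t ∈ complex.faces, s ⊆ t ∧ t.card = d + 1

/-- The closed simplex spanned by a finite set of vertices. -/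
def cell {d : ℕ} (s : Finset (E d)) : Set (E d) := convexHull ℝ (s : Set (E d))

/-- The radius of the inscribed ball of a simplex: the largest radius of a ball inside it. -/
def inradius {d : ℕ} (s : Finset (E d)) : ℝ :=
  sSup {ρ : ℝ | 0 ≤ ρ ∧ ∃ c : E d, Metric.closedBall c ρ ⊆ cell s}

/-- Two simplices are connected if they, as closed sets, have a point in common. -/
def Touches {d : ℕ} (s t : Finset (E d)) : Prop := (cell s ∩ cell t).Nonempty

namespace SimplicialPartition

variable {d : ℕ} (Δ : SimplicialPartition d)

/-- The (closed) polyhedral domain `Ω` that is partitioned. -/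
def domain : Set (E d) := Δ.complex.space

/-- The `d`-dimensional simplices of the partition, each given by its vertices. -/
def simplices : Set (Finset (E d)) := {T | T ∈ Δ.complex.faces ∧ T.card = d + 1}

/-- The vertices that lie in the interior of the domain. -/
def interiorVertices : Set (E d) := {v | v ∈ Δ.complex.vertices ∧ v ∈ interior Δ.domain}

/-- The mesh size `|Δ|`: the largest diameter of a simplex. -/
def meshSize : ℝ := ⨆ T : Δ.simplices, Metric.diam (cell (T : Finset (E d)))

/-- `β`-quasi-uniformity: `|Δ| / ρ_T ≤ β` for every simplex `T`, with `ρ_T` its inradius. -/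
def QuasiUniform (β : ℝ) : Prop := ∀ T ∈ Δ.simplices, Δ.meshSize / inradius T ≤ β

/-- The simplices of `star^k(T)`: `star^0(T) = {T}`, and `star^(k+1)(T)` consists of the
simplices connected to some simplex of `star^k(T)`. -/
def star (T : Finset (E d)) : ℕ → Set (Finset (E d))
  | 0 => {T}
  | k + 1 => {S | S ∈ Δ.simplices ∧ ∃ U ∈ star T k, Touches S U}

/-- The point set covered by `star^k(T)`. -/
def starRegion (T : Finset (E d)) (k : ℕ) : Set (E d) := ⋃ S ∈ Δ.star T k, cell S

/-- There are simplices `T = c 0, c 1, …, c L`, consecutive ones connected, the last one of which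
meets the boundary of the domain. -/
def HasBoundaryChain (T : Finset (E d)) (L : ℕ) : Prop :=
  ∃ c : ℕ → Finset (E d), c 0 = T ∧ (∀ j ≤ L, c j ∈ Δ.simplices) ∧
    (∀ j < L, Touches (c j) (c (j + 1))) ∧ (cell (c L) ∩ frontier Δ.domain).Nonempty

/-- `T` is `L` simplices away from the boundary: `L` is the least length of a chain of simplices
from `T` to the boundary. -/
def IsSimplicesAway (T : Finset (E d)) (L : ℕ) : Prop := IsLeast {m | Δ.HasBoundaryChain T m} L

/-- The spline space `S^r_n(Δ)`: the functions on the domain that are polynomials of total degree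
at most `n` on each simplex, are continuous on the domain and `r` times continuously
differentiable in its interior.  Functions are extended by `0` outside the domain. -/
def splineSpace (r n : ℕ) : Submodule ℝ (E d → ℝ) where
  carrier := {u | ContinuousOn u Δ.domain ∧ ContDiffOn ℝ r u (interior Δ.domain) ∧
    (∀ T ∈ Δ.simplices, ∃ p : MvPolynomial (Fin d) ℝ, p.totalDegree ≤ n ∧
      ∀ x ∈ cell T, u x = MvPolynomial.eval (fun i => x i) p) ∧
    ∀ x ∉ Δ.domain, u x = 0}
  zero_mem' := ⟨continuousOn_const, contDiffOn_const,
    fun _ _ => ⟨0, by simp, by simp⟩, fun _ _ => rfl⟩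
  add_mem' := by
    rintro u w ⟨hu1, hu2, hu3, hu4⟩ ⟨hw1, hw2, hw3, hw4⟩
    refine ⟨hu1.add hw1, hu2.add hw2, fun T hT => ?_, fun x hx => ?_⟩
    · obtain ⟨p, hp, hpu⟩ := hu3 T hT
      obtain ⟨q, hq, hqw⟩ := hw3 T hT
      refine ⟨p + q, (MvPolynomial.totalDegree_add p q).trans (max_le hp hq), fun x hx => ?_⟩
      simp [hpu x hx, hqw x hx]
    · simp [hu4 x hx, hw4 x hx]
  smul_mem' := by
    rintro a u ⟨hu1, hu2, hu3, hu4⟩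
    refine ⟨hu1.const_smul a, hu2.const_smul a, fun T hT => ?_, fun x hx => ?_⟩
    · obtain ⟨p, hp, hpu⟩ := hu3 T hT
      refine ⟨a • p, (MvPolynomial.totalDegree_smul_le a p).trans hp, fun x hx => ?_⟩
      simp [hpu x hx, MvPolynomial.smul_eval]
    · simp [hu4 x hx]

/-- The space `W = S^r_n(Δ) ∩ H¹₀(Ω)`: the splines that vanish on the boundary (the splines are
continuous and piecewise polynomial, so membership in `H¹₀` means zero boundary values). -/
def splineSpaceZero (r n : ℕ) : Submodule ℝ (E d → ℝ) where
  carrier := {u | u ∈ Δ.splineSpace r n ∧ ∀ x ∈ frontier Δ.domain, u x = 0}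
  zero_mem' := ⟨Submodule.zero_mem _, fun _ _ => rfl⟩
  add_mem' := by
    rintro u w ⟨hu, hu'⟩ ⟨hw, hw'⟩
    exact ⟨Submodule.add_mem _ hu hw, fun x hx => by simp [hu' x hx, hw' x hx]⟩
  smul_mem' := by
    rintro a u ⟨hu, hu'⟩
    exact ⟨Submodule.smul_mem _ a hu, fun x hx => by simp [hu' x hx]⟩

/-- The Dirichlet form `⟨∇u, ∇w⟩ = ∫_Ω ∇u · ∇w`.  A spline is a polynomial inside each simplex, so
the pointwise gradient exists almost everywhere and is the weak gradient. -/
def dirichlet (u w : E d → ℝ) : ℝ := ∫ x in Δ.domain, inner ℝ (gradient u x) (gradient w x)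

/-- `h` is the hat function of the vertex `v`: the continuous piecewise linear function with value
`1` at `v` and `0` at every other vertex. -/
def IsHat (v : E d) (h : E d → ℝ) : Prop :=
  h ∈ Δ.splineSpace 0 1 ∧ h v = 1 ∧ ∀ w ∈ Δ.complex.vertices, w ≠ v → h w = 0

/-- The enlarged support of a hat function `h`: the union of `star^1(t)` over all simplices `t`
contained in the support of `h`. -/
def enlargedSupport (h : E d → ℝ) : Set (E d) :=
  ⋃ t ∈ {t | t ∈ Δ.simplices ∧ cell t ⊆ tsupport h}, Δ.starRegion t 1

/-- `R` is the discrete interior GBC function in `S^r_n(Δ)` of the hat function `h`: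
the weak solution `R ∈ W` of `⟨∇R, ∇w⟩ = -⟨h, w⟩` for all `w ∈ W`. -/
def IsInteriorGBC (r n : ℕ) (h R : E d → ℝ) : Prop :=
  R ∈ Δ.splineSpaceZero r n ∧
    ∀ w ∈ Δ.splineSpaceZero r n, Δ.dirichlet R w = -∫ x in Δ.domain, h x * w x

/-- The basis `B` of `W` is `1`-local and bounded by `K₁`: each basis function is bounded by `K₁`
in absolute value and is supported in `star(T_ξ)` for some simplex `T_ξ`. -/
def IsLocalBasis {r n m : ℕ} (B : Module.Basis (Fin m) ℝ (Δ.splineSpaceZero r n)) (K₁ : ℝ) :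
    Prop :=
  ∀ ξ : Fin m, (∀ x, |(B ξ : E d → ℝ) x| ≤ K₁) ∧
    ∃ T ∈ Δ.simplices, tsupport (B ξ : E d → ℝ) ⊆ Δ.starRegion T 1

/-- The stability of the basis `B` in the norm `‖∇ ·‖_{L²(Ω)}` of `W`, with constants `C₁, C₂`. -/
def IsStableBasis {r n m : ℕ} (B : Module.Basis (Fin m) ℝ (Δ.splineSpaceZero r n)) (C₁ C₂ : ℝ) :
    Prop :=
  ∀ c : Fin m → ℝ,
    C₁ * ∑ ξ, c ξ ^ 2 ≤ Δ.dirichlet (∑ ξ, c ξ • (B ξ : E d → ℝ)) (∑ ξ, c ξ • (B ξ : E d → ℝ)) ∧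
    Δ.dirichlet (∑ ξ, c ξ • (B ξ : E d → ℝ)) (∑ ξ, c ξ • (B ξ : E d → ℝ)) ≤ C₂ * ∑ ξ, c ξ ^ 2

end SimplicialPartition

end GBC

end

/-! ### Barycentric coordinates and hat functions -/

open MeasureTheory Set

noncomputable section

namespace GBC

open Filter Topology

variable {d : ℕ}

/-! Decay. Expand `R = ∑ c_ξ B_ξ`. Then `A c = b`, where `A` is the stiffness matrix and `b_ξ = -⟨h,
B_ξ⟩`. Stability says that the quadratic form of `A` lies between `C₁` and `C₂` times the Euclidean
one. Locality says that `A` couples only basis functions whose simplices are at most three stars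
apart, and that `b` vanishes at every basis function supported away from the hat.

Run gradient descent for the homogeneous problem, starting from `c` itself: `e ↦ e - C₂⁻¹ A e`. Each
step multiplies the energy `e ⬝ᵥ A *ᵥ e` by at most `1 - C₁ / C₂`, yet it leaves `e` alone wherever
`A e = 0`. Since `A c = b` is zero near `T` and `A` is sparse, the modification creeps towards `T`
by only three stars per step. So after about `k / 3` steps the entries near `T` are still those of
`c`, while the energy, which bounds their squares, has become exponentially small
(`mul_sq_le_of_sparse`).

The rest is counting: disjoint inscribed balls bound the number of simplices near a given one, and
linear independence in a space of piecewise polynomials then bounds the number of basis functions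
there (`QuasiUniform.card_localBasis_le`). This controls both the initial energy and the number of
terms in `R v`. The factor `L + 1` is at least `1`, so it only weakens the bound obtained.

Local basis for `r = 0`. On each simplex write a spline as a form of degree `n` in the barycentric
coordinates and set to zero the coordinates of all vertices outside a set `A`; this is `homogExt`.
Adding the vertices to `A` one by one writes the spline as a telescoping sum of splines that each
live on the star of one vertex. Hence local splines span, and a basis can be selected among them
(`span_localSplines`). Its stability is compactness of the unit sphere.

Existence and uniqueness. A spline in `W` of zero Dirichlet energy is zero, so on the
finite-dimensional `W` the form induces an isomorphism onto the dual. -/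

theorem isCompact_cell (s : Finset (E d)) : IsCompact (cell s) :=
  s.finite_toSet.isCompact_convexHull ℝ

theorem convex_cell (s : Finset (E d)) : Convex ℝ (cell s) := convex_convexHull ℝ _

theorem mem_cell_of_mem {s : Finset (E d)} {v : E d} (hv : v ∈ s) : v ∈ cell s :=
  subset_convexHull ℝ _ hv

theorem mem_cell_iff {s : Finset (E d)} {x : E d} :
    x ∈ cell s ↔ ∃ w : E d → ℝ, (∀ y ∈ s, 0 ≤ w y) ∧ ∑ y ∈ s, w y = 1 ∧ ∑ y ∈ s, w y • y = x :=
  Finset.mem_convexHull'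

namespace SimplicialPartition

variable (Δ : SimplicialPartition d)

theorem finite_simplices : Δ.simplices.Finite := Δ.finite_faces.subset fun _ h => h.1

theorem domain_eq : Δ.domain = ⋃ T ∈ Δ.simplices, cell T := by
  ext x
  simp only [domain, Geometry.SimplicialComplex.mem_space_iff, mem_iUnion, exists_prop]
  constructor
  · rintro ⟨s, hs, hx⟩
    obtain ⟨t, ht, hst, hc⟩ := Δ.pure s hs
    exact ⟨t, ⟨ht, hc⟩, convexHull_mono (by exact_mod_cast hst) hx⟩
  · rintro ⟨T, hT, hx⟩
    exact ⟨T, hT.1, hx⟩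

variable {Δ} in
theorem mem_domain_iff {x : E d} : x ∈ Δ.domain ↔ ∃ T ∈ Δ.simplices, x ∈ cell T := by
  simp [domain_eq]

variable {Δ} in
theorem cell_subset_domain {T : Finset (E d)} (hT : T ∈ Δ.simplices) : cell T ⊆ Δ.domain :=
  fun _ hx => mem_domain_iff.2 ⟨T, hT, hx⟩

theorem isCompact_domain : IsCompact Δ.domain := by
  rw [domain_eq]
  exact Δ.finite_simplices.isCompact_biUnion fun T _ => isCompact_cell T

theorem exists_simplex_of_mem_vertices {v : E d} (hv : v ∈ Δ.complex.vertices) :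
    ∃ T ∈ Δ.simplices, v ∈ T := by
  obtain ⟨t, ht, hst, hc⟩ := Δ.pure {v} hv
  exact ⟨t, ⟨ht, hc⟩, by simpa using hst⟩

variable {Δ} in
theorem mem_vertices_of_mem {T : Finset (E d)} (hT : T ∈ Δ.simplices) {v : E d} (hv : v ∈ T) :
    v ∈ Δ.complex.vertices :=
  Δ.complex.down_closed hT.1 (by simpa using hv) (by simp)

variable {Δ} in
theorem affineSpan_eq_top {T : Finset (E d)} (hT : T ∈ Δ.simplices) :
    affineSpan ℝ (T : Set (E d)) = ⊤ := by
  have h := (Δ.complex.indep hT.1).affineSpan_eq_top_iff_card_eq_finrank_add_one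
  simpa [hT.2] using h

variable {Δ} in
theorem interior_cell_nonempty {T : Finset (E d)} (hT : T ∈ Δ.simplices) :
    (interior (cell T)).Nonempty :=
  interior_convexHull_nonempty_iff_affineSpan_eq_top.2 (affineSpan_eq_top hT)

variable {Δ} in
-- The affine coordinates of the basis formed by the vertices of `T`, extended by zero to all other
-- points. Indexing by points of the space, and not by vertices of `T`, allows the coordinates of
-- different simplices to be compared.
theorem exists_bary {T : Finset (E d)} (hT : T ∈ Δ.simplices) :
    ∃ b : E d → (E d →ᵃ[ℝ] ℝ), (∀ v ∉ T, b v = 0) ∧ (∀ x, ∑ v ∈ T, b v x = 1) ∧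
      (∀ x, ∑ v ∈ T, b v x • v = x) ∧
      (∀ s ⊆ T, ∀ w : E d → ℝ, ∑ y ∈ s, w y = 1 →
        ∀ v ∈ s, b v (∑ y ∈ s, w y • y) = w v) ∧
      (∀ s ⊆ T, ∀ w : E d → ℝ, ∑ y ∈ s, w y = 1 →
        ∀ v ∉ s, b v (∑ y ∈ s, w y • y) = 0) ∧
      (interior (cell T) = {x | ∀ v ∈ T, 0 < b v x}) := by
  classical
  let B : AffineBasis T ℝ (E d) := ⟨((↑) : T → E d), Δ.complex.indep hT.1, by
    simpa using affineSpan_eq_top hT⟩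
  have hB : ∀ v : T, B v = v := fun _ => rfl
  let b : E d → (E d →ᵃ[ℝ] ℝ) := fun v => if h : v ∈ T then B.coord ⟨v, h⟩ else 0
  have hb : ∀ v : T, b v = B.coord v := fun v => by simp [b]
  have hb0 : ∀ v ∉ T, b v = 0 := fun v hv => by simp [b, hv]
  have hvert : ∀ v, ∀ y ∈ T, b v y = if v = y then 1 else 0 := by
    intro v y hy
    by_cases hv : v ∈ T
    · have := B.coord_apply ⟨v, hv⟩ ⟨y, hy⟩
      simpa [b, hv, hB] using this
    · have : v ≠ y := by rintro rfl; exact hv hy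
      simp [b, hv, this]
  have hcomb : ∀ s ⊆ T, ∀ w : E d → ℝ, ∑ y ∈ s, w y = 1 →
        ∀ v, b v (∑ y ∈ s, w y • y) = ∑ y ∈ s, w y * (if v = y then 1 else 0) := by
    intro s hs w hw v
    rw [← Finset.affineCombination_eq_linear_combination s (fun y => y) w hw,
      Finset.map_affineCombination _ _ _ hw, Finset.affineCombination_eq_linear_combination _ _ _ hw]
    exact Finset.sum_congr rfl fun y hy => by simp [hvert v y (hs hy)]
  refine ⟨b, hb0, fun x => ?_, fun x => ?_, fun s hs w hw v hv => ?_, fun s hs w hw v hv => ?_, ?_⟩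
  · rw [← Finset.sum_coe_sort T (fun v => b v x)]
    simp only [hb]
    exact B.sum_coord_apply_eq_one x
  · rw [← Finset.sum_coe_sort T (fun v => b v x • v)]
    simp only [hb]
    exact B.linear_combination_coord_eq_self x
  · simp [hcomb s hs w hw v, hv]
  · rw [hcomb s hs w hw v]
    refine Finset.sum_eq_zero fun y hy => ?_
    have : v ≠ y := by rintro rfl; exact hv hy
    simp [this]
  · have := B.interior_convexHull
    have hr : range B = (T : Set (E d)) := by ext; simp [hB]
    rw [hr] at this
    rw [cell, this]
    ext x
    simp only [mem_ofPred_eq]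
    exact ⟨fun h v hv => by have := h ⟨v, hv⟩; rwa [← hb] at this, fun h v => by
      rw [← hb]; exact h v v.2⟩

/-- The barycentric coordinates with respect to a simplex `T` of the partition, as affine functions
on the whole space; the coordinates of points that are not vertices of `T` vanish. -/
def bary (T : Finset (E d)) (v : E d) : E d →ᵃ[ℝ] ℝ :=
  open Classical in if hT : T ∈ Δ.simplices then (exists_bary hT).choose v else 0

section bary

variable {Δ} {T : Finset (E d)}

theorem bary_spec (hT : T ∈ Δ.simplices) :
    (∀ v ∉ T, Δ.bary T v = 0) ∧ (∀ x, ∑ v ∈ T, Δ.bary T v x = 1) ∧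
      (∀ x, ∑ v ∈ T, Δ.bary T v x • v = x) ∧
      (∀ s ⊆ T, ∀ w : E d → ℝ, ∑ y ∈ s, w y = 1 →
        ∀ v ∈ s, Δ.bary T v (∑ y ∈ s, w y • y) = w v) ∧
      (∀ s ⊆ T, ∀ w : E d → ℝ, ∑ y ∈ s, w y = 1 →
        ∀ v ∉ s, Δ.bary T v (∑ y ∈ s, w y • y) = 0) ∧
      (interior (cell T) = {x | ∀ v ∈ T, 0 < Δ.bary T v x}) := by
  have := (exists_bary hT).choose_spec
  simpa only [bary, hT, dite_true] using this

theorem bary_of_notMem (hT : T ∈ Δ.simplices)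
    {v : E d} (hv : v ∉ T) (x : E d) : Δ.bary T v x = 0 := by
  rw [(bary_spec hT).1 v hv]; rfl

theorem sum_bary (hT : T ∈ Δ.simplices)
    (x : E d) : ∑ v ∈ T, Δ.bary T v x = 1 := (bary_spec hT).2.1 x

theorem sum_bary_smul (hT : T ∈ Δ.simplices)
    (x : E d) : ∑ v ∈ T, Δ.bary T v x • v = x := (bary_spec hT).2.2.1 x

theorem bary_combination_of_mem (hT : T ∈ Δ.simplices) {s : Finset (E d)} (hs : s ⊆ T) {w : E d → ℝ}
    (hw : ∑ y ∈ s, w y = 1) {v : E d} (hv : v ∈ s) : Δ.bary T v (∑ y ∈ s, w y • y) = w v :=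
  (bary_spec hT).2.2.2.1 s hs w hw v hv

theorem bary_combination_of_notMem (hT : T ∈ Δ.simplices)
    {s : Finset (E d)} (hs : s ⊆ T) {w : E d → ℝ}
    (hw : ∑ y ∈ s, w y = 1) {v : E d} (hv : v ∉ s) : Δ.bary T v (∑ y ∈ s, w y • y) = 0 :=
  (bary_spec hT).2.2.2.2.1 s hs w hw v hv

theorem interior_cell (hT : T ∈ Δ.simplices) :
    interior (cell T) = {x | ∀ v ∈ T, 0 < Δ.bary T v x} :=
  (bary_spec hT).2.2.2.2.2

theorem bary_nonneg (hT : T ∈ Δ.simplices)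
    {x : E d} (hx : x ∈ cell T) (v : E d) : 0 ≤ Δ.bary T v x := by
  obtain ⟨w, hw0, hw1, rfl⟩ := mem_cell_iff.1 hx
  by_cases hv : v ∈ T
  · rw [bary_combination_of_mem hT subset_rfl hw1 hv]; exact hw0 v hv
  · rw [bary_of_notMem hT hv]

theorem mem_cell_of_bary_nonneg (hT : T ∈ Δ.simplices)
    {x : E d} (h : ∀ v ∈ T, 0 ≤ Δ.bary T v x) : x ∈ cell T :=
  mem_cell_iff.2 ⟨fun v => Δ.bary T v x, h, sum_bary hT x, sum_bary_smul hT x⟩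

theorem bary_self (hT : T ∈ Δ.simplices) {v : E d} (hv : v ∈ T) : Δ.bary T v v = 1 := by
  have := bary_combination_of_mem hT (s := {v}) (by simpa using hv) (w := fun _ => 1) (by simp)
    (v := v) (by simp)
  simpa using this

theorem bary_of_ne (hT : T ∈ Δ.simplices)
    {v w : E d} (hw : w ∈ T) (hvw : v ≠ w) : Δ.bary T v w = 0 := by
  have := bary_combination_of_notMem hT (s := {w}) (by simpa using hw) (w := fun _ => 1) (by simp)
    (v := v) (by simpa using hvw)
  simpa using this

theorem bary_le_one (hT : T ∈ Δ.simplices)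
    {x : E d} (hx : x ∈ cell T) (v : E d) : Δ.bary T v x ≤ 1 := by
  by_cases hv : v ∈ T
  · rw [← sum_bary hT x]
    exact Finset.single_le_sum (f := fun v => Δ.bary T v x) (fun w _ => bary_nonneg hT hx w) hv
  · rw [bary_of_notMem hT hv]; exact zero_le_one

theorem mem_of_bary_ne_zero (hT : T ∈ Δ.simplices) {v x : E d} (h : Δ.bary T v x ≠ 0) : v ∈ T := by
  by_contra hv
  exact h (bary_of_notMem hT hv x)

/-- Two simplices meet only in the hull of their common vertices, and on that hull both systems read
off the same weights. This makes `hat` independent of the simplex chosen. -/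
theorem bary_eq_bary (hT : T ∈ Δ.simplices)
    {S : Finset (E d)} (hS : S ∈ Δ.simplices) {x : E d} (hxT : x ∈ cell T)
    (hxS : x ∈ cell S) (v : E d) : Δ.bary T v x = Δ.bary S v x := by
  classical
  have h := Δ.complex.inter_subset_convexHull hT.1 hS.1 ⟨hxT, hxS⟩
  rw [← Finset.coe_inter] at h
  obtain ⟨w, -, hw1, rfl⟩ := mem_cell_iff.1 h
  by_cases hv : v ∈ T ∩ S
  · rw [bary_combination_of_mem hT Finset.inter_subset_left hw1 hv,
      bary_combination_of_mem hS Finset.inter_subset_right hw1 hv]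
  · rw [bary_combination_of_notMem hT Finset.inter_subset_left hw1 hv,
      bary_combination_of_notMem hS Finset.inter_subset_right hw1 hv]

theorem closure_interior_cell (hT : T ∈ Δ.simplices) : closure (interior (cell T)) = cell T := by
  rw [(convex_cell T).closure_interior_eq_closure_of_nonempty_interior (interior_cell_nonempty hT),
    (isCompact_cell T).isClosed.closure_eq]

end bary

/-- The hat function of a vertex, given by barycentric coordinates on each simplex. -/
def hat (v x : E d) : ℝ :=
  open Classical in if h : ∃ T ∈ Δ.simplices, x ∈ cell T then Δ.bary h.choose v x else 0

variable {Δ}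

theorem hat_eq_bary {T : Finset (E d)} (hT : T ∈ Δ.simplices) {x : E d} (hx : x ∈ cell T)
    (v : E d) : Δ.hat v x = Δ.bary T v x := by
  have h : ∃ T ∈ Δ.simplices, x ∈ cell T := ⟨T, hT, hx⟩
  rw [hat, dif_pos h]
  exact bary_eq_bary h.choose_spec.1 hT h.choose_spec.2 hx v

theorem hat_of_notMem {x : E d} (hx : x ∉ Δ.domain) (v : E d) : Δ.hat v x = 0 := by
  rw [hat, dif_neg (by rwa [← mem_domain_iff])]

theorem hat_nonneg (v x : E d) : 0 ≤ Δ.hat v x := by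
  by_cases hx : x ∈ Δ.domain
  · obtain ⟨T, hT, hxT⟩ := mem_domain_iff.1 hx
    rw [hat_eq_bary hT hxT]; exact bary_nonneg hT hxT v
  · rw [hat_of_notMem hx]

theorem hat_le_one (v x : E d) : Δ.hat v x ≤ 1 := by
  by_cases hx : x ∈ Δ.domain
  · obtain ⟨T, hT, hxT⟩ := mem_domain_iff.1 hx
    rw [hat_eq_bary hT hxT]; exact bary_le_one hT hxT v
  · rw [hat_of_notMem hx]; exact zero_le_one

/-- Near a point, only the simplices that contain it are met. -/
theorem eventually_mem_cell_imp (y : E d) :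
    ∀ᶠ z in 𝓝 y, ∀ S ∈ Δ.simplices, z ∈ cell S → y ∈ cell S := by
  rw [eventually_all_finite Δ.finite_simplices]
  intro S _
  by_cases hy : y ∈ cell S
  · exact Eventually.of_forall fun _ _ => hy
  · filter_upwards [(isCompact_cell S).isClosed.isOpen_compl.mem_nhds hy] with z hz hzS
    exact absurd hzS hz

/-- A boundary point has all of its carrier face in the boundary. -/
theorem mem_frontier_of_bary {T : Finset (E d)} (hT : T ∈ Δ.simplices) {x y : E d}
    (hx : x ∈ cell T) (hy : y ∈ cell T) (hxf : x ∈ frontier Δ.domain)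
    (hxy : ∀ v, Δ.bary T v y ≠ 0 → Δ.bary T v x ≠ 0) : y ∈ frontier Δ.domain := by
  classical
  have hclosed := Δ.isCompact_domain.isClosed
  rw [hclosed.frontier_eq] at hxf ⊢
  refine ⟨cell_subset_domain hT hy, fun hyi => hxf.2 ?_⟩
  -- If `y` were interior, a point `y'` slightly off `y` towards `x` would be interior too, with
  -- exactly the same nonzero coordinates as `x`.
  obtain ⟨ε, hεi, hε0, hε1⟩ : ∃ ε : ℝ, AffineMap.lineMap y x ε ∈ interior Δ.domain ∧
      0 < ε ∧ ε < 1 := by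
    have hc : Continuous (fun ε : ℝ => AffineMap.lineMap y x ε) := AffineMap.lineMap_continuous
    have h1 : ∀ᶠ ε : ℝ in 𝓝[>] 0, AffineMap.lineMap y x ε ∈ interior Δ.domain := by
      refine nhdsWithin_le_nhds (hc.continuousAt.eventually_mem ?_)
      simpa using isOpen_interior.mem_nhds hyi
    have h2 : ∀ᶠ ε : ℝ in 𝓝[>] 0, ε ∈ Ioo (0 : ℝ) 1 := Ioo_mem_nhdsGT one_pos
    obtain ⟨ε, h, h'⟩ := (h1.and h2).exists
    exact ⟨ε, h, h'.1, h'.2⟩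
  set y' : E d := AffineMap.lineMap y x ε with hy'
  have by' : ∀ v, Δ.bary T v y' = (1 - ε) * Δ.bary T v y + ε * Δ.bary T v x := by
    intro v
    rw [hy', AffineMap.apply_lineMap, AffineMap.lineMap_apply_module]; simp
  have hpos : ∀ v, Δ.bary T v x ≠ 0 → 0 < Δ.bary T v y' := by
    intro v hv
    have h1 := (bary_nonneg hT hx v).lt_of_ne' hv
    have h2 := bary_nonneg hT hy v
    rw [by']
    have : 0 < 1 - ε := by linarith
    positivity
  have hzero : ∀ v, Δ.bary T v x = 0 → Δ.bary T v y' = 0 := by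
    intro v hv
    have : Δ.bary T v y = 0 := by by_contra h; exact hxy v h hv
    rw [by', hv, this]; simp
  have hy'T : y' ∈ cell T := by
    refine mem_cell_of_bary_nonneg hT fun v _ => ?_
    by_cases hv : Δ.bary T v x = 0
    · rw [hzero v hv]
    · exact (hpos v hv).le
  obtain ⟨δ, hδ0, hδ⟩ : ∃ δ : ℝ, 0 < δ ∧ ∀ v ∈ T, 0 ≤ (1 + δ) * Δ.bary T v x -
      δ * Δ.bary T v y' := by
    have : ∀ᶠ δ : ℝ in 𝓝[>] 0, ∀ v ∈ T, 0 ≤ (1 + δ) * Δ.bary T v x - δ * Δ.bary T v y' := by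
      rw [Finset.eventually_all]
      intro v _
      by_cases hv : Δ.bary T v x = 0
      · simp [hv, hzero v hv]
      · have h1 := (bary_nonneg hT hx v).lt_of_ne' hv
        have hc : Continuous (fun δ : ℝ => (1 + δ) * Δ.bary T v x - δ * Δ.bary T v y') := by
          fun_prop
        refine nhdsWithin_le_nhds ((hc.continuousAt.eventually_mem
          (isOpen_Ioi.mem_nhds (?_ : _ ∈ Ioi (0 : ℝ)))).mono fun δ h => le_of_lt h)
        simpa using h1
    obtain ⟨δ, h, h'⟩ := (this.and self_mem_nhdsWithin).exists
    exact ⟨δ, h', h⟩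
  -- `z` lies on the line from `y'` through `x`, a little beyond `x`, and `δ` is small enough to
  -- keep it in the face that carries `x`. Every simplex containing `y'` contains all vertices of
  -- that face, hence `z`.
  set z : E d := AffineMap.lineMap x y' (-δ) with hz
  have bz : ∀ v, Δ.bary T v z = (1 + δ) * Δ.bary T v x - δ * Δ.bary T v y' := by
    intro v
    rw [hz, AffineMap.apply_lineMap, AffineMap.lineMap_apply_module]; simp; ring
  have hzS : ∀ S ∈ Δ.simplices, y' ∈ cell S → z ∈ cell S := by
    intro S hS hyS
    have hzT : z ∈ cell T := mem_cell_of_bary_nonneg hT fun v hv => by rw [bz]; exact hδ v hv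
    have hsub : (T.filter fun v => Δ.bary T v x ≠ 0) ⊆ S := by
      intro v hv
      refine mem_of_bary_ne_zero hS (x := y') ?_
      rw [← bary_eq_bary hT hS hy'T hyS]
      exact (hpos v (Finset.mem_filter.1 hv).2).ne'
    refine convexHull_mono (by exact_mod_cast hsub) (mem_cell_iff.2 ⟨fun v => Δ.bary T v z,
      fun v _ => bary_nonneg hT hzT v, ?_, ?_⟩)
    · rw [← sum_bary hT z, Finset.sum_filter_of_ne]
      intro v _ hv hvx
      exact hv (by rw [bz, hzero v hvx, hvx]; simp)
    · conv_rhs => rw [← sum_bary_smul hT z]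
      rw [Finset.sum_filter_of_ne]
      intro v _ hv hvx
      exact hv (by simp [bz, hzero v hvx, hvx])
  -- The dilation about `z` with ratio `(1 + δ) / δ` maps `x` to `y'`. A point `p` near `x` goes to
  -- a point of the domain near `y'`, which lies in a simplex containing `y'` and so also `z`. By
  -- convexity that simplex contains `p`, so `x` is interior, a contradiction.
  have hφ : ∀ p : E d, AffineMap.lineMap z (AffineMap.lineMap z p ((1 + δ) / δ) : E d)
      (δ / (1 + δ)) = p := by
    intro p
    simp only [AffineMap.lineMap_apply_module]
    rw [smul_add, smul_smul, smul_smul, ← add_assoc, ← add_smul]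
    have h1 : δ / (1 + δ) * ((1 + δ) / δ) = 1 := by field_simp
    have h2 : 1 - δ / (1 + δ) + δ / (1 + δ) * (1 - (1 + δ) / δ) = 0 := by
      rw [mul_sub, h1]; ring
    rw [h1, h2]; simp
  have hxy' : (AffineMap.lineMap z x ((1 + δ) / δ) : E d) = y' := by
    rw [hz]
    simp only [AffineMap.lineMap_apply_module]
    rw [smul_add, smul_smul, smul_smul, add_right_comm, ← add_smul]
    have h1 : (1 - (1 + δ) / δ) * (1 - -δ) + (1 + δ) / δ = 0 := by field_simp; ring
    have h2 : (1 - (1 + δ) / δ) * -δ = 1 := by field_simp; ring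
    rw [h1, h2]; simp
  have hcont : Continuous (fun p : E d => (AffineMap.lineMap z p ((1 + δ) / δ) : E d)) := by
    simp only [AffineMap.lineMap_apply_module]; fun_prop
  have hev := (eventually_mem_cell_imp (Δ := Δ) y').and (isOpen_interior.mem_nhds hεi)
  rw [← hxy'] at hev
  rw [mem_interior_iff_mem_nhds]
  filter_upwards [hcont.continuousAt.eventually hev] with p hp
  rw [hxy'] at hp
  obtain ⟨S, hS, hpS⟩ := mem_domain_iff.1 (interior_subset hp.2)
  have := (convex_cell S).lineMap_mem (hzS S hS (hp.1 S hS hpS)) hpS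
    (t := δ / (1 + δ)) ⟨by positivity, by rw [div_le_one (by positivity)]; linarith⟩
  rw [hφ] at this
  exact cell_subset_domain hS this

end SimplicialPartition

end GBC

/-! ### Polynomials, spline spaces and their dimension -/

namespace GBC

open Filter Topology

variable {d : ℕ}

theorem contDiff_eval (p : MvPolynomial (Fin d) ℝ) {k : WithTop ℕ∞} :
    ContDiff ℝ k fun x : E d => MvPolynomial.eval (fun i => x i) p := by
  induction p using MvPolynomial.induction_on with
  | C a => simpa using contDiff_const
  | add p q hp hq => simpa using hp.add hq
  | mul_X p i hp =>
    simp only [map_mul, MvPolynomial.eval_X]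
    exact hp.mul (contDiff_piLp_apply (p := 2) (i := i))

theorem continuous_eval (p : MvPolynomial (Fin d) ℝ) :
    Continuous fun x : E d => MvPolynomial.eval (fun i => x i) p :=
  (contDiff_eval p (k := 0)).continuous

theorem exists_eval_eq_affineMap (f : E d →ᵃ[ℝ] ℝ) :
    ∃ p : MvPolynomial (Fin d) ℝ, p.totalDegree ≤ 1 ∧
      ∀ x : E d, MvPolynomial.eval (fun i => x i) p = f x := by
  refine ⟨∑ i, MvPolynomial.C (f.linear (EuclideanSpace.single i 1)) * MvPolynomial.X i +
    MvPolynomial.C (f 0), ?_, fun x => ?_⟩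
  · refine (MvPolynomial.totalDegree_add _ _).trans (max_le ?_ (by simp))
    refine MvPolynomial.totalDegree_finsetSum_le fun i _ => ?_
    refine (MvPolynomial.totalDegree_mul _ _).trans ?_
    simp
  · have hx : x = ∑ i, x i • EuclideanSpace.single i (1 : ℝ) := by
      ext j; simp [Finset.sum_apply, Pi.single_apply]
    have := f.decomp
    rw [show f x = f.linear x + f 0 from congrFun this x]
    conv_rhs => rw [hx]
    simp [mul_comm]

theorem exists_affineMap_eq_eval (p : MvPolynomial (Fin d) ℝ) (hp : p.totalDegree ≤ 1) :
    ∃ f : E d →ᵃ[ℝ] ℝ, ∀ x : E d, f x = MvPolynomial.eval (fun i => x i) p := by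
  rw [← MvPolynomial.mem_restrictTotalDegree, MvPolynomial.restrictTotalDegree,
    MvPolynomial.restrictSupport_eq_span] at hp
  induction hp using Submodule.span_induction with
  | zero => exact ⟨0, by simp⟩
  | add p q _ _ hp hq =>
    obtain ⟨f, hf⟩ := hp
    obtain ⟨g, hg⟩ := hq
    exact ⟨f + g, by simp [hf, hg]⟩
  | smul a p _ hp =>
    obtain ⟨f, hf⟩ := hp
    exact ⟨a • f, by simp [hf, MvPolynomial.smul_eval]⟩
  | mem p hp =>
    obtain ⟨m, hm, rfl⟩ := hp
    have hm' : m.degree ≤ 1 := hm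
    rcases Nat.le_one_iff_eq_zero_or_eq_one.1 hm' with h | h
    · rw [Finsupp.degree_eq_zero_iff] at h
      subst h
      exact ⟨AffineMap.const ℝ (E d) 1, by simp⟩
    · obtain ⟨i, rfl⟩ : m ∈ range fun i => Finsupp.single i 1 := by
        rw [Finsupp.range_single_one]; exact h
      refine ⟨(EuclideanSpace.proj i : E d →L[ℝ] ℝ).toLinearMap.toAffineMap, fun x => ?_⟩
      simp [MvPolynomial.eval_monomial]

namespace SimplicialPartition

variable {Δ : SimplicialPartition d}

theorem continuousOn_domain_of_cells {F : Type*} [TopologicalSpace F] {u : E d → F}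
    (h : ∀ T ∈ Δ.simplices, ContinuousOn u (cell T)) : ContinuousOn u Δ.domain := by
  have : Finite Δ.simplices := Δ.finite_simplices
  rw [domain_eq, biUnion_eq_iUnion]
  exact (locallyFinite_of_finite _).continuousOn_iUnion
    (fun T => (isCompact_cell _).isClosed) fun T => h T T.2

theorem mem_splineSpace_zero {n : ℕ} {u : E d → ℝ}
    (h : ∀ T ∈ Δ.simplices, ∃ p : MvPolynomial (Fin d) ℝ, p.totalDegree ≤ n ∧
      ∀ x ∈ cell T, u x = MvPolynomial.eval (fun i => x i) p)
    (h0 : ∀ x ∉ Δ.domain, u x = 0) : u ∈ Δ.splineSpace 0 n := by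
  have hc : ContinuousOn u Δ.domain := by
    refine continuousOn_domain_of_cells fun T hT => ?_
    obtain ⟨p, -, hp⟩ := h T hT
    exact (continuous_eval p).continuousOn.congr hp
  exact ⟨hc, contDiffOn_zero.2 (hc.mono interior_subset), h, h0⟩

theorem isHat_hat {v : E d} (hv : v ∈ Δ.complex.vertices) : Δ.IsHat v (Δ.hat v) := by
  refine ⟨mem_splineSpace_zero (fun T hT => ?_) fun x hx => hat_of_notMem hx v, ?_,
    fun w hw hwv => ?_⟩
  · obtain ⟨p, hp, hpb⟩ := exists_eval_eq_affineMap (Δ.bary T v)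
    exact ⟨p, hp, fun x hx => by rw [hpb, hat_eq_bary hT hx]⟩
  · obtain ⟨T, hT, hvT⟩ := Δ.exists_simplex_of_mem_vertices hv
    rw [hat_eq_bary hT (mem_cell_of_mem hvT), bary_self hT hvT]
  · obtain ⟨T, hT, hwT⟩ := Δ.exists_simplex_of_mem_vertices hw
    rw [hat_eq_bary hT (mem_cell_of_mem hwT), bary_of_ne hT hwT hwv.symm]

/-- On each simplex a polynomial of degree at most one is affine, hence determined by its values at
the vertices. -/
theorem IsHat.eq_hat {v : E d} {h : E d → ℝ} (hh : Δ.IsHat v h) : h = Δ.hat v := by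
  classical
  obtain ⟨⟨-, -, hp, h0⟩, hv1, hw⟩ := hh
  ext x
  by_cases hx : x ∈ Δ.domain
  · obtain ⟨T, hT, hxT⟩ := mem_domain_iff.1 hx
    obtain ⟨p, hpd, hpe⟩ := hp T hT
    obtain ⟨f, hf⟩ := exists_affineMap_eq_eval p hpd
    have hvert : ∀ w ∈ T, f w = if w = v then 1 else 0 := by
      intro w hwT
      rw [hf, ← hpe w (mem_cell_of_mem hwT)]
      split_ifs with hwv
      · rw [hwv, hv1]
      · exact hw w (mem_vertices_of_mem hT hwT) hwv
    rw [hat_eq_bary hT hxT, hpe x hxT, ← hf]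
    have hs := sum_bary hT x
    conv_lhs => rw [← sum_bary_smul hT x]
    rw [← Finset.affineCombination_eq_linear_combination T (fun y => y) _ hs,
      Finset.map_affineCombination _ _ _ hs, Finset.affineCombination_eq_linear_combination _ _ _ hs]
    have : ∀ w ∈ T, Δ.bary T w x • (f ∘ fun y => y) w = if w = v then Δ.bary T v x else 0 := by
      intro w hwT
      simp only [Function.comp_apply, hvert w hwT]
      split_ifs with hwv
      · simp [hwv]
      · simp
    rw [Finset.sum_congr rfl this, Finset.sum_ite_eq']
    split_ifs with hvT
    · rfl
    · rw [bary_of_notMem hT hvT]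
  · rw [h0 x hx, hat_of_notMem hx]

variable {r n : ℕ}

/-- Zero boundary values let the spline be pasted to its extension by zero along the frontier.
Continuity on the whole, connected space is what the definiteness of the Dirichlet form rests on. -/
theorem continuous_of_mem_splineSpaceZero {u : E d → ℝ} (hu : u ∈ Δ.splineSpaceZero r n) :
    Continuous u := by
  have hcl := Δ.isCompact_domain.isClosed
  have h1 : ContinuousOn u Δ.domain := hu.1.1
  have h2 : ContinuousOn u (closure Δ.domainᶜ) := by
    refine continuousOn_const (c := (0 : ℝ)) |>.congr fun x hx => ?_
    by_cases hxd : x ∈ Δ.domain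
    · exact hu.2 x (by rw [frontier_eq_closure_inter_closure]; exact ⟨subset_closure hxd, hx⟩)
    · exact hu.1.2.2.2 x hxd
  have := h1.union_of_isClosed h2 hcl isClosed_closure
  have huniv : Δ.domain ∪ closure Δ.domainᶜ = univ :=
    eq_univ_of_forall fun x => (em (x ∈ Δ.domain)).imp id fun h => subset_closure h
  rwa [huniv, continuousOn_univ] at this

/-- The functions that are given by polynomials of degree at most `n` on each of the simplices
in `𝒯` and vanish elsewhere, parametrized by the polynomials; on the overlap of simplices, one of
the polynomials is used. -/
def glue (𝒯 : Finset (Finset (E d))) (n : ℕ) :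
    (𝒯 → MvPolynomial.restrictTotalDegree (Fin d) ℝ n) →ₗ[ℝ] (E d → ℝ) where
  toFun p x := open Classical in if h : ∃ T : 𝒯, x ∈ cell (T : Finset (E d)) then
    MvPolynomial.eval (fun i => x i) (p h.choose : MvPolynomial (Fin d) ℝ) else 0
  map_add' p q := by
    ext x
    by_cases h : ∃ T : 𝒯, x ∈ cell (T : Finset (E d)) <;> simp [h]
  map_smul' a p := by
    ext x
    by_cases h : ∃ T : 𝒯, x ∈ cell (T : Finset (E d)) <;> simp [h, MvPolynomial.smul_eval]

theorem mem_range_glue (𝒯 : Finset (Finset (E d))) {u : E d → ℝ}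
    (h : ∀ T ∈ 𝒯, ∃ p : MvPolynomial (Fin d) ℝ, p.totalDegree ≤ n ∧
      ∀ x ∈ cell T, u x = MvPolynomial.eval (fun i => x i) p)
    (h0 : ∀ x, (∀ T ∈ 𝒯, x ∉ cell T) → u x = 0) : u ∈ LinearMap.range (glue 𝒯 n) := by
  choose! p hp hpu using h
  refine ⟨fun T => ⟨p T, (MvPolynomial.mem_restrictTotalDegree _ _ _).2 (hp T T.2)⟩, ?_⟩
  ext x
  by_cases hx : ∃ T : 𝒯, x ∈ cell (T : Finset (E d))
  · simp only [glue, LinearMap.coe_mk, AddHom.coe_mk, dif_pos hx]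
    exact (hpu _ hx.choose.2 x hx.choose_spec).symm
  · simp only [glue, LinearMap.coe_mk, AddHom.coe_mk, dif_neg hx]
    push Not at hx
    exact (h0 x fun T hT => hx ⟨T, hT⟩).symm

/-- One polynomial per simplex suffices, so linearly independent splines living on few simplices are
few. -/
theorem finrank_range_glue_le (𝒯 : Finset (Finset (E d))) :
    Module.finrank ℝ (LinearMap.range (glue 𝒯 n)) ≤
      𝒯.card * Module.finrank ℝ (MvPolynomial.restrictTotalDegree (Fin d) ℝ n) := by
  refine (LinearMap.finrank_range_le _).trans ?_
  rw [Module.finrank_pi_fintype]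
  simp

variable (Δ r n) in
theorem finiteDimensional_splineSpaceZero : FiniteDimensional ℝ (Δ.splineSpaceZero r n) := by
  have hle : Δ.splineSpaceZero r n ≤ LinearMap.range (glue Δ.finite_simplices.toFinset n) := by
    intro u hu
    refine mem_range_glue _ (fun T hT => hu.1.2.2.1 T (by simpa using hT)) fun x hx => ?_
    refine hu.1.2.2.2 x fun hxd => ?_
    obtain ⟨T, hT, hxT⟩ := mem_domain_iff.1 hxd
    exact hx T (by simpa using hT) hxT
  exact Submodule.finiteDimensional_of_le hle

end SimplicialPartition

end GBC

/-! ### The Dirichlet form and the solution of the variational problem -/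

namespace GBC

open Filter Topology

variable {d : ℕ}

theorem continuous_gradient {f : E d → ℝ} (hf : ContDiff ℝ 1 f) : Continuous (gradient f) :=
  (InnerProductSpace.toDual ℝ (E d)).symm.continuous.comp (hf.continuous_fderiv one_ne_zero)

theorem gradient_add {f g : E d → ℝ} {x : E d} (hf : DifferentiableAt ℝ f x)
    (hg : DifferentiableAt ℝ g x) : gradient (f + g) x = gradient f x + gradient g x := by
  simp [gradient, fderiv_add hf hg]

theorem gradient_const_smul {f : E d → ℝ} {x : E d} (hf : DifferentiableAt ℝ f x) (a : ℝ) :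
    gradient (a • f) x = a • gradient f x := by
  simp [gradient, fderiv_const_smul hf a]

namespace SimplicialPartition

variable {Δ : SimplicialPartition d} {r n : ℕ}

theorem exists_eventuallyEq_eval {u : E d → ℝ} (hu : u ∈ Δ.splineSpace r n)
    {T : Finset (E d)} (hT : T ∈ Δ.simplices) :
    ∃ p : MvPolynomial (Fin d) ℝ, (∀ x ∈ cell T, u x = MvPolynomial.eval (fun i => x i) p) ∧
      ∀ x ∈ interior (cell T), u =ᶠ[𝓝 x] fun x => MvPolynomial.eval (fun i => x i) p := by
  obtain ⟨p, -, hp⟩ := hu.2.2.1 T hT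
  refine ⟨p, hp, fun x hx => ?_⟩
  filter_upwards [mem_interior_iff_mem_nhds.1 hx] with y hy using hp y hy

theorem differentiableAt_of_mem_interior {u : E d → ℝ} (hu : u ∈ Δ.splineSpace r n)
    {T : Finset (E d)} (hT : T ∈ Δ.simplices) {x : E d} (hx : x ∈ interior (cell T)) :
    DifferentiableAt ℝ u x := by
  obtain ⟨p, -, hp⟩ := exists_eventuallyEq_eval hu hT
  exact ((contDiff_eval p).differentiable one_ne_zero x).congr_of_eventuallyEq (hp x hx)

/-- The frontier of a convex set is null, so gradients of splines need only be known inside the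
simplices, where the spline is locally a polynomial. -/
theorem ae_mem_interior_cell (T : Finset (E d)) :
    ∀ᵐ x ∂volume.restrict (cell T), x ∈ interior (cell T) := by
  rw [ae_restrict_iff' (isCompact_cell T).measurableSet]
  have h : ∀ᵐ x : E d, x ∉ frontier (cell T) :=
    measure_eq_zero_iff_ae_notMem.1 ((convex_cell T).addHaar_frontier volume)
  filter_upwards [h] with x hx hxT
  by_contra hxi
  exact hx ((isCompact_cell T).isClosed.frontier_eq ▸ ⟨hxT, hxi⟩)

theorem ae_domain_iff {P : E d → Prop} :
    (∀ᵐ x ∂volume.restrict Δ.domain, P x) ↔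
      ∀ T ∈ Δ.simplices, ∀ᵐ x ∂volume.restrict (cell T), P x := by
  rw [domain_eq]
  exact ae_restrict_biUnion_iff _ Δ.finite_simplices.countable _

theorem ae_domain_of_interior {P : E d → Prop}
    (h : ∀ T ∈ Δ.simplices, ∀ x ∈ interior (cell T), P x) :
    ∀ᵐ x ∂volume.restrict Δ.domain, P x :=
  ae_domain_iff.2 fun T hT => (ae_mem_interior_cell T).mono (h T hT)

theorem integrableOn_inner_gradient {u w : E d → ℝ} (hu : u ∈ Δ.splineSpace r n)
    (hw : w ∈ Δ.splineSpace r n) :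
    IntegrableOn (fun x => inner ℝ (gradient u x) (gradient w x)) Δ.domain := by
  rw [domain_eq, integrableOn_finite_biUnion Δ.finite_simplices]
  intro T hT
  obtain ⟨p, -, hp⟩ := exists_eventuallyEq_eval hu hT
  obtain ⟨q, -, hq⟩ := exists_eventuallyEq_eval hw hT
  have hc : Continuous fun x => inner ℝ
      (gradient (fun x : E d => MvPolynomial.eval (fun i => x i) p) x)
      (gradient (fun x : E d => MvPolynomial.eval (fun i => x i) q) x) :=
    (continuous_gradient (contDiff_eval p)).inner (continuous_gradient (contDiff_eval q))
  refine (hc.continuousOn.integrableOn_compact (isCompact_cell T)).congr ?_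
  filter_upwards [ae_mem_interior_cell T] with x hx
  rw [(hp x hx).gradient_eq, (hq x hx).gradient_eq]

theorem dirichlet_comm (u w : E d → ℝ) : Δ.dirichlet u w = Δ.dirichlet w u := by
  simp only [dirichlet, real_inner_comm]

theorem dirichlet_add_left {u u' w : E d → ℝ} (hu : u ∈ Δ.splineSpace r n)
    (hu' : u' ∈ Δ.splineSpace r n) (hw : w ∈ Δ.splineSpace r n) :
    Δ.dirichlet (u + u') w = Δ.dirichlet u w + Δ.dirichlet u' w := by
  rw [dirichlet, dirichlet, dirichlet, ← integral_add (integrableOn_inner_gradient hu hw)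
    (integrableOn_inner_gradient hu' hw)]
  refine integral_congr_ae (ae_domain_of_interior fun T hT x hx => ?_)
  simp only
  rw [gradient_add (differentiableAt_of_mem_interior hu hT hx)
    (differentiableAt_of_mem_interior hu' hT hx), inner_add_left]

theorem dirichlet_smul_left {u : E d → ℝ} (hu : u ∈ Δ.splineSpace r n) (a : ℝ) (w : E d → ℝ) :
    Δ.dirichlet (a • u) w = a * Δ.dirichlet u w := by
  rw [dirichlet, dirichlet, ← integral_const_mul]
  refine integral_congr_ae (ae_domain_of_interior fun T hT x hx => ?_)
  simp only
  rw [gradient_const_smul (differentiableAt_of_mem_interior hu hT hx), real_inner_smul_left]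

variable (Δ r n) in
/-- The Dirichlet form on the splines with zero boundary values. -/
def dirichletForm : LinearMap.BilinForm ℝ (Δ.splineSpaceZero r n) :=
  LinearMap.mk₂ ℝ (fun u w => Δ.dirichlet u w)
    (fun u u' w => dirichlet_add_left u.2.1 u'.2.1 w.2.1)
    (fun a u w => dirichlet_smul_left u.2.1 a w)
    (fun u w w' => by
      rw [dirichlet_comm, dirichlet_comm (u : E d → ℝ), dirichlet_comm (u : E d → ℝ)]
      exact dirichlet_add_left w.2.1 w'.2.1 u.2.1)
    (fun a u w => by
      rw [dirichlet_comm, dirichlet_comm (u : E d → ℝ)]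
      exact dirichlet_smul_left w.2.1 a u)

theorem dirichletForm_apply (u w : Δ.splineSpaceZero r n) :
    Δ.dirichletForm r n u w = Δ.dirichlet u w := rfl

theorem dirichlet_self_nonneg (u : E d → ℝ) : 0 ≤ Δ.dirichlet u u :=
  integral_nonneg fun _ => real_inner_self_nonneg

theorem exists_eq_const_on_cell {u : E d → ℝ} (hu : u ∈ Δ.splineSpace r n)
    (h : Δ.dirichlet u u = 0) {T : Finset (E d)} (hT : T ∈ Δ.simplices) :
    ∃ a, ∀ x ∈ cell T, u x = a := by
  obtain ⟨p, hpu, hp⟩ := exists_eventuallyEq_eval hu hT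
  set f := fun x : E d => MvPolynomial.eval (fun i => x i) p with hf
  have h0 : ∀ᵐ x ∂volume.restrict Δ.domain, inner ℝ (gradient u x) (gradient u x) = 0 :=
    (integral_eq_zero_iff_of_nonneg (fun _ => real_inner_self_nonneg)
      (integrableOn_inner_gradient hu hu)).1 h
  have h1 : gradient f =ᵐ[volume.restrict (interior (cell T))] fun _ => 0 := by
    have h2 := ae_restrict_of_ae_restrict_of_subset interior_subset (ae_domain_iff.1 h0 T hT)
    filter_upwards [h2, ae_restrict_mem isOpen_interior.measurableSet] with x hx hxi
    rwa [inner_self_eq_zero, (hp x hxi).gradient_eq] at hx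
  have h2 := Measure.eqOn_open_of_ae_eq h1 isOpen_interior
    (continuous_gradient (contDiff_eval p)).continuousOn continuousOn_const
  have hd : Differentiable ℝ f := (contDiff_eval p).differentiable one_ne_zero
  obtain ⟨a, ha⟩ := isOpen_interior.exists_is_const_of_fderiv_eq_zero (𝕜 := ℝ)
    (convex_cell T).interior.isPreconnected (f := f) hd.differentiableOn
    (fun x hx => by
      have := h2 hx
      simpa [gradient] using this)
  refine ⟨a, fun x hx => ?_⟩
  rw [hpu x hx]
  have hcl : IsClosed {x | f x = a} := isClosed_eq hd.continuous continuous_const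
  rw [← closure_interior_cell hT] at hx
  exact closure_minimal (fun y hy => ha y hy) hcl hx

/-- The spline is constant on each of finitely many simplices and zero outside, so it has finite
range. Being continuous on a connected space it is constant, and it vanishes somewhere because the
domain is bounded. -/
theorem eq_zero_of_dirichlet_self_eq_zero [Nontrivial (E d)] {u : E d → ℝ}
    (hu : u ∈ Δ.splineSpaceZero r n) (h : Δ.dirichlet u u = 0) : u = 0 := by
  have hfin : (range u).Finite := by
    have hsub : range u ⊆ insert 0 (⋃ T ∈ Δ.simplices, u '' cell T) := by
      rintro _ ⟨x, rfl⟩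
      by_cases hx : x ∈ Δ.domain
      · obtain ⟨T, hT, hxT⟩ := mem_domain_iff.1 hx
        exact Or.inr (mem_iUnion₂.2 ⟨T, hT, x, hxT, rfl⟩)
      · exact Or.inl (hu.1.2.2.2 x hx)
    refine (Finite.insert 0 (Δ.finite_simplices.biUnion fun T hT => ?_)).subset hsub
    obtain ⟨a, ha⟩ := exists_eq_const_on_cell hu.1 h hT
    refine (finite_singleton a).subset ?_
    rintro _ ⟨x, hx, rfl⟩
    exact ha x hx
  have hsub : (range u).Subsingleton :=
    hfin.countable.isTotallyDisconnected _ subset_rfl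
      (isPreconnected_range (continuous_of_mem_splineSpaceZero hu))
  obtain ⟨y, hy⟩ := (ne_univ_iff_exists_notMem _).1 Δ.isCompact_domain.ne_univ
  ext x
  rw [hsub ⟨x, rfl⟩ ⟨y, rfl⟩, hu.1.2.2.2 y hy]; rfl

theorem integrableOn_mul {f w : E d → ℝ} (hf : ContinuousOn f Δ.domain)
    (hw : ContinuousOn w Δ.domain) : IntegrableOn (fun x => f x * w x) Δ.domain :=
  (hf.mul hw).integrableOn_compact Δ.isCompact_domain

theorem existsUnique_isInteriorGBC [Nontrivial (E d)] {h : E d → ℝ}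
    (hh : ContinuousOn h Δ.domain) : ∃! R, Δ.IsInteriorGBC r n h R := by
  have := Δ.finiteDimensional_splineSpaceZero r n
  let ℓ : Module.Dual ℝ (Δ.splineSpaceZero r n) :=
    { toFun := fun w => -∫ x in Δ.domain, h x * (w : E d → ℝ) x
      map_add' := fun w w' => by
        rw [← neg_add, ← integral_add (integrableOn_mul hh w.2.1.1) (integrableOn_mul hh w'.2.1.1)]
        simp [mul_add]
      map_smul' := fun a w => by
        simp only [RingHom.id_apply, smul_eq_mul, mul_neg, ← integral_const_mul]
        simp [mul_left_comm] }
  have hinj : Function.Injective (Δ.dirichletForm r n) := by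
    rw [injective_iff_map_eq_zero]
    intro u hu
    have h0 : Δ.dirichlet u u = 0 := congrArg (fun φ => φ u) hu
    exact Subtype.ext (eq_zero_of_dirichlet_self_eq_zero u.2 h0)
  have hsurj : Function.Surjective (Δ.dirichletForm r n) :=
    (LinearMap.injective_iff_surjective_of_finrank_eq_finrank
      (Subspace.dual_finrank_eq (K := ℝ) (V := Δ.splineSpaceZero r n)).symm).1 hinj
  obtain ⟨R, hR⟩ := hsurj ℓ
  refine ⟨R, ⟨R.2, fun w hw => congrArg (fun φ => φ ⟨w, hw⟩) hR⟩, fun R' hR' => ?_⟩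
  have : (⟨R', hR'.1⟩ : Δ.splineSpaceZero r n) = R := by
    apply hinj
    rw [hR]
    ext w
    exact hR'.2 w w.2
  exact congrArg Subtype.val this

end SimplicialPartition

end GBC

/-! ### Decay for sparse, well-conditioned linear systems -/

namespace GBC

open Filter Topology Matrix

section decay

variable {ι : Type*} [Fintype ι] {A : Matrix ι ι ℝ} {C₁ C₂ : ℝ}

theorem dotProduct_self_nonneg (x : ι → ℝ) : 0 ≤ x ⬝ᵥ x :=
  Finset.sum_nonneg fun i _ => mul_self_nonneg (x i)

theorem sq_dotProduct_le (x y : ι → ℝ) : (x ⬝ᵥ y) ^ 2 ≤ (x ⬝ᵥ x) * (y ⬝ᵥ y) := by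
  have := Finset.sum_mul_sq_le_sq_mul_sq Finset.univ x y
  simpa [dotProduct, pow_two] using this

/-- Cauchy–Schwarz bounds the squared energy by `(c ⬝ᵥ c)` times the squared length of `A *ᵥ c`; the
lower bound `hlow` then allows one factor of the energy to be cancelled. -/
theorem energy_le (h1 : 0 < C₁) (hlow : ∀ c, C₁ * (c ⬝ᵥ c) ≤ c ⬝ᵥ A *ᵥ c) (c : ι → ℝ) :
    C₁ * (c ⬝ᵥ A *ᵥ c) ≤ (A *ᵥ c) ⬝ᵥ (A *ᵥ c) := by
  have h := sq_dotProduct_le c (A *ᵥ c)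
  have h2 := hlow c
  have h3 := dotProduct_self_nonneg c
  have h4 := dotProduct_self_nonneg (A *ᵥ c)
  set e := c ⬝ᵥ A *ᵥ c
  rcases (mul_nonneg h1.le h3 |>.trans h2).eq_or_lt with h0 | h0
  · rw [← h0]; simpa using h4
  · refine le_of_mul_le_mul_left ?_ h0
    calc e * (C₁ * e) = C₁ * e ^ 2 := by ring
      _ ≤ C₁ * ((c ⬝ᵥ c) * ((A *ᵥ c) ⬝ᵥ (A *ᵥ c))) := by gcongr
      _ = (C₁ * (c ⬝ᵥ c)) * ((A *ᵥ c) ⬝ᵥ (A *ᵥ c)) := by ring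
      _ ≤ e * ((A *ᵥ c) ⬝ᵥ (A *ᵥ c)) := by gcongr

/-- With `g` the squared length of `A *ᵥ c`, the energy changes by `-2 g / C₂` plus a quadratic term
that `hup` bounds by `g / C₂`. The net gain `g / C₂` is at least `C₁ / C₂` times the energy by
`energy_le`. -/
theorem energy_gradient_step_le (hA : A.IsSymm) (h1 : 0 < C₁) (h2 : 0 < C₂)
    (hlow : ∀ c, C₁ * (c ⬝ᵥ c) ≤ c ⬝ᵥ A *ᵥ c) (hup : ∀ c, c ⬝ᵥ A *ᵥ c ≤ C₂ * (c ⬝ᵥ c))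
    (c : ι → ℝ) :
    (c - C₂⁻¹ • A *ᵥ c) ⬝ᵥ A *ᵥ (c - C₂⁻¹ • A *ᵥ c) ≤ (1 - C₁ / C₂) * (c ⬝ᵥ A *ᵥ c) := by
  have hs : c ⬝ᵥ A *ᵥ A *ᵥ c = (A *ᵥ c) ⬝ᵥ (A *ᵥ c) := by
    rw [dotProduct_mulVec, ← mulVec_transpose, hA.eq]
  have hu := hup (A *ᵥ c)
  have hE := energy_le h1 hlow c
  rw [mulVec_sub, mulVec_smul, sub_dotProduct, dotProduct_sub, dotProduct_sub, smul_dotProduct,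
    smul_dotProduct, dotProduct_smul, dotProduct_smul, hs]
  simp only [smul_eq_mul]
  set g := (A *ᵥ c) ⬝ᵥ (A *ᵥ c)
  set e := c ⬝ᵥ A *ᵥ c
  have h3 : C₂⁻¹ * (C₂⁻¹ * ((A *ᵥ c) ⬝ᵥ A *ᵥ A *ᵥ c)) ≤ C₂⁻¹ * g := by
    have : C₂⁻¹ * ((A *ᵥ c) ⬝ᵥ A *ᵥ A *ᵥ c) ≤ g := by
      rw [inv_mul_le_iff₀ h2]; exact hu
    gcongr
  have h4 : C₁ / C₂ * e ≤ C₂⁻¹ * g := by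
    rw [div_eq_inv_mul, mul_assoc]; gcongr
  linarith

/-- Exponential decay of the solution of a sparse, well-conditioned linear system away from the
support of its right-hand side. -/
theorem mul_sq_le_of_sparse (hA : A.IsSymm) (h1 : 0 < C₁) (h2 : 0 < C₂)
    (hlow : ∀ c, C₁ * (c ⬝ᵥ c) ≤ c ⬝ᵥ A *ᵥ c) (hup : ∀ c, c ⬝ᵥ A *ᵥ c ≤ C₂ * (c ⬝ᵥ c))
    {q : ℝ} (hq0 : 0 ≤ q) (hq : 1 - C₁ / C₂ ≤ q) (c : ι → ℝ) (lev : ℕ → Set ι) (m : ℕ)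
    (hlev : ∀ j < m, ∀ ξ ∈ lev j, ∀ η, A ξ η ≠ 0 → η ∈ lev (j + 1))
    (hb : ∀ j < m, ∀ ξ ∈ lev j, (A *ᵥ c) ξ = 0) {ξ : ι} (hξ : ξ ∈ lev 0) :
    C₁ * c ξ ^ 2 ≤ q ^ m * (c ⬝ᵥ A *ᵥ c) := by
  -- `e` is the result of `j` gradient steps from `c`. On `lev i` row `ξ` of `A` sees only entries
  -- in `lev (i + 1)`, where `e` still equals `c`; so `A e = A c = 0` there and the step changes
  -- nothing. Each step costs one level.
  have key : ∀ j, ∃ e : ι → ℝ, (∀ i, i + j ≤ m → ∀ ξ ∈ lev i, e ξ = c ξ) ∧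
      e ⬝ᵥ A *ᵥ e ≤ q ^ j * (c ⬝ᵥ A *ᵥ c) := by
    intro j
    induction j with
    | zero => exact ⟨c, fun _ _ _ _ => rfl, by simp⟩
    | succ j ih =>
      obtain ⟨e, he, hE⟩ := ih
      have he0 : 0 ≤ e ⬝ᵥ A *ᵥ e :=
        (mul_nonneg h1.le (dotProduct_self_nonneg e)).trans (hlow e)
      refine ⟨e - C₂⁻¹ • A *ᵥ e, fun i hi ξ hξ => ?_, ?_⟩
      · have : (A *ᵥ e) ξ = (A *ᵥ c) ξ := by
          refine Finset.sum_congr rfl fun η _ => ?_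
          by_cases h : A ξ η = 0
          · simp [h]
          · rw [he (i + 1) (by omega) η (hlev i (by omega) ξ hξ η h)]
        simp [this, hb i (by omega) ξ hξ, he i (by omega) ξ hξ]
      · calc _ ≤ (1 - C₁ / C₂) * (e ⬝ᵥ A *ᵥ e) := energy_gradient_step_le hA h1 h2 hlow hup e
          _ ≤ q * (q ^ j * (c ⬝ᵥ A *ᵥ c)) := by gcongr
          _ = _ := by ring
  obtain ⟨e, he, hE⟩ := key m
  have h3 : e ξ ^ 2 ≤ e ⬝ᵥ e := by
    rw [pow_two]
    exact Finset.single_le_sum (f := fun i => e i * e i) (fun i _ => mul_self_nonneg (e i))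
      (Finset.mem_univ ξ)
  rw [← he 0 (by omega) ξ hξ]
  calc C₁ * e ξ ^ 2 ≤ C₁ * (e ⬝ᵥ e) := by gcongr
    _ ≤ _ := (hlow e).trans hE

end decay

/-! ### Stars, counting by volume, and the support of the hat function -/

variable {d : ℕ}

theorem Touches.symm {S T : Finset (E d)} (h : Touches S T) : Touches T S := by
  rwa [Touches, inter_comm]

namespace SimplicialPartition

variable {Δ : SimplicialPartition d} {r n : ℕ} {S T : Finset (E d)} {k : ℕ}

theorem touches_self (hT : T ∈ Δ.simplices) : Touches T T := by
  obtain ⟨x, hx⟩ := interior_cell_nonempty hT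
  exact ⟨x, interior_subset hx, interior_subset hx⟩

theorem mem_simplices_of_mem_star (hT : T ∈ Δ.simplices) (hS : S ∈ Δ.star T k) :
    S ∈ Δ.simplices := by
  cases k with
  | zero => rwa [show S = T from hS]
  | succ k => exact hS.1

theorem mem_star_succ {U : Finset (E d)} (hU : U ∈ Δ.star T k) (hS : S ∈ Δ.simplices)
    (h : Touches S U) : S ∈ Δ.star T (k + 1) := ⟨hS, U, hU, h⟩

theorem star_mono (hT : T ∈ Δ.simplices) : Monotone (Δ.star T) :=
  monotone_nat_of_le_succ fun _ _ hS =>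
    mem_star_succ hS (mem_simplices_of_mem_star hT hS)
      (touches_self (mem_simplices_of_mem_star hT hS))

theorem mem_starRegion_one {x : E d} :
    x ∈ Δ.starRegion T 1 ↔ ∃ S ∈ Δ.simplices, Touches S T ∧ x ∈ cell S := by
  simp [starRegion, star, and_assoc]

/-- If the first stars of `S` and `U` meet, then `U` is at distance at most `3` from `S`. -/
theorem mem_star_add_three (hS : S ∈ Δ.star T k) {U : Finset (E d)} (hU : U ∈ Δ.simplices)
    {x : E d} (hxS : x ∈ Δ.starRegion S 1) (hxU : x ∈ Δ.starRegion U 1) :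
    U ∈ Δ.star T (k + 3) := by
  obtain ⟨S', hS', hSS', hx⟩ := mem_starRegion_one.1 hxS
  obtain ⟨U', hU', hUU', hx'⟩ := mem_starRegion_one.1 hxU
  exact mem_star_succ (mem_star_succ (mem_star_succ hS hS' hSS') hU' ⟨x, hx', hx⟩) hU hUU'.symm

theorem diam_cell_le (hT : T ∈ Δ.simplices) : Metric.diam (cell T) ≤ Δ.meshSize := by
  have : Finite Δ.simplices := Δ.finite_simplices
  exact le_ciSup (f := fun T : Δ.simplices => Metric.diam (cell (T : Finset (E d))))
    (finite_range _).bddAbove ⟨T, hT⟩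

theorem dist_le_meshSize (hT : T ∈ Δ.simplices) {x y : E d} (hx : x ∈ cell T) (hy : y ∈ cell T) :
    dist x y ≤ Δ.meshSize :=
  (Metric.dist_le_diam_of_mem (isCompact_cell T).isBounded hx hy).trans (diam_cell_le hT)

theorem dist_le_of_mem_star (hT : T ∈ Δ.simplices) {x y : E d} (hx : x ∈ cell T)
    (hS : S ∈ Δ.star T k) (hy : y ∈ cell S) : dist y x ≤ (k + 1) * Δ.meshSize := by
  induction k generalizing S y with
  | zero =>
    rw [show S = T from hS] at hy
    simpa using dist_le_meshSize hT hy hx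
  | succ k ih =>
    obtain ⟨hSs, U, hU, z, hzS, hzU⟩ := hS
    have h1 := ih hU hzU
    have h2 := dist_le_meshSize hSs hy hzS
    have h3 := dist_triangle y z x
    push_cast
    linarith

theorem bddAbove_inradius [Nontrivial (E d)] (T : Finset (E d)) :
    BddAbove {ρ : ℝ | 0 ≤ ρ ∧ ∃ c : E d, Metric.closedBall c ρ ⊆ cell T} := by
  refine ⟨Metric.diam (cell T), fun ρ ⟨h0, c, hc⟩ => ?_⟩
  have := Metric.diam_mono hc (isCompact_cell T).isBounded
  rw [Metric.diam_closedBall_eq c h0] at this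
  linarith

theorem inradius_pos [Nontrivial (E d)] (hT : T ∈ Δ.simplices) : 0 < inradius T := by
  obtain ⟨x, hx⟩ := interior_cell_nonempty hT
  obtain ⟨ε, hε, h⟩ := Metric.nhds_basis_closedBall.mem_iff.1 (mem_interior_iff_mem_nhds.1 hx)
  exact hε.trans_le (le_csSup (bddAbove_inradius T) ⟨hε.le, x, h⟩)

theorem meshSize_pos [Nontrivial (E d)] (hT : T ∈ Δ.simplices) : 0 < Δ.meshSize := by
  obtain ⟨x, hx⟩ := interior_cell_nonempty hT
  obtain ⟨ε, hε, h⟩ := Metric.nhds_basis_closedBall.mem_iff.1 (mem_interior_iff_mem_nhds.1 hx)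
  have := Metric.diam_mono h (isCompact_cell T).isBounded
  rw [Metric.diam_closedBall_eq x hε.le] at this
  linarith [diam_cell_le hT]

theorem QuasiUniform.pos [Nontrivial (E d)] {β : ℝ} (h : Δ.QuasiUniform β)
    (hT : T ∈ Δ.simplices) : 0 < β :=
  (div_pos (meshSize_pos hT) (inradius_pos hT)).trans_le (h T hT)

/-- The inradius is at least `meshSize / β`. Halving makes the inequality strict, so a ball exists
without showing that the supremum is attained. -/
theorem QuasiUniform.exists_ball_subset [Nontrivial (E d)] {β : ℝ} (h : Δ.QuasiUniform β)
    (hT : T ∈ Δ.simplices) : ∃ c : E d, Metric.ball c (Δ.meshSize / (2 * β)) ⊆ cell T := by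
  have hβ := h.pos hT
  have hr := inradius_pos hT
  have hm := meshSize_pos hT
  have h1 : Δ.meshSize / (2 * β) < inradius T := by
    have := h T hT
    rw [div_le_iff₀ hr] at this
    rw [div_lt_iff₀ (by positivity)]
    nlinarith [mul_pos hβ hr]
  obtain ⟨ρ, ⟨-, c, hc⟩, hρ⟩ := exists_lt_of_lt_csSup
    (by by_contra hne
        rw [not_nonempty_iff_eq_empty] at hne
        rw [inradius, hne, Real.sSup_empty] at hr
        exact hr.false) h1
  exact ⟨c, (Metric.ball_subset_closedBall.trans (Metric.closedBall_subset_closedBall hρ.le)).trans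
    hc⟩

/-- An overlap would be an open subset of the hull of `T ∩ S`. There the coordinate of a vertex of
`T` missing from `S` vanishes, whereas it is positive in the interior of `T`. -/
theorem disjoint_of_subset_cell (hT : T ∈ Δ.simplices) (hS : S ∈ Δ.simplices) (hTS : T ≠ S)
    {U V : Set (E d)} (hU : IsOpen U) (hV : IsOpen V) (hUT : U ⊆ cell T) (hVS : V ⊆ cell S) :
    Disjoint U V := by
  classical
  rw [Set.disjoint_iff_inter_eq_empty, ← not_nonempty_iff_eq_empty]
  intro hne
  have h := (inter_subset_inter hUT hVS).trans (Δ.complex.inter_subset_convexHull hT.1 hS.1)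
  rw [← Finset.coe_inter] at h
  obtain ⟨x, hx⟩ := hne
  have hxi : x ∈ interior (cell (T ∩ S)) := mem_interior.2 ⟨_, h, hU.inter hV, hx⟩
  obtain ⟨v, hvT, hvS⟩ : ∃ v ∈ T, v ∉ S := by
    by_contra! hsub
    exact hTS (Finset.eq_of_subset_of_card_le hsub (by rw [hT.2, hS.2]))
  have hxT : x ∈ interior (cell T) :=
    interior_mono (convexHull_mono (by exact_mod_cast Finset.inter_subset_left)) hxi
  rw [interior_cell hT] at hxT
  have hpos := hxT v hvT
  obtain ⟨w, -, hw1, rfl⟩ := mem_cell_iff.1 (interior_subset hxi)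
  rw [bary_combination_of_notMem hT Finset.inter_subset_left hw1
    (fun hv => hvS (Finset.mem_inter.1 hv).2)] at hpos
  exact hpos.false

/-- The number of simplices of a quasi-uniform partition that lie in a ball. -/
theorem QuasiUniform.card_le [Nontrivial (E d)] {β : ℝ} (h : Δ.QuasiUniform β)
    (hβ : 0 < β) (hm : 0 < Δ.meshSize) {𝒯 : Finset (Finset (E d))} (h𝒯 : ∀ T ∈ 𝒯, T ∈ Δ.simplices)
    {x : E d} {a : ℝ} (ha : 0 ≤ a)
    (hx : ∀ T ∈ 𝒯, cell T ⊆ Metric.closedBall x (a * Δ.meshSize)) :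
    (𝒯.card : ℝ) ≤ (2 * β * a) ^ d := by
  choose! c hc using fun T (hT : T ∈ 𝒯) => h.exists_ball_subset (h𝒯 T hT)
  set ρ := Δ.meshSize / (2 * β) with hρ
  have hρ0 : 0 < ρ := by positivity
  have hdisj : (𝒯 : Set (Finset (E d))).PairwiseDisjoint fun T => Metric.ball (c T) ρ :=
    fun T hT S hS hTS => disjoint_of_subset_cell (h𝒯 T hT) (h𝒯 S hS) hTS Metric.isOpen_ball
      Metric.isOpen_ball (hc T hT) (hc S hS)
  -- Volume comparison: the disjoint balls of radius `ρ`, one in each simplex, all fit into the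
  -- large ball.
  have h1 : volume (⋃ T ∈ 𝒯, Metric.ball (c T) ρ) ≤
      volume (Metric.closedBall x (a * Δ.meshSize)) :=
    measure_mono (iUnion₂_subset fun T hT => (hc T hT).trans (hx T hT))
  rw [measure_biUnion_finset hdisj fun T _ => measurableSet_ball] at h1
  have h2 : ∀ T ∈ 𝒯, volume (Metric.ball (c T) ρ) =
      ENNReal.ofReal (ρ ^ d) * volume (Metric.ball (0 : E d) 1) := fun T _ => by
    rw [Measure.addHaar_ball _ _ hρ0.le]; simp
  rw [Finset.sum_congr rfl h2, Finset.sum_const, Measure.addHaar_closedBall _ _ (by positivity),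
    nsmul_eq_mul, ← mul_assoc] at h1
  have h3 := (ENNReal.mul_le_mul_iff_left (Metric.measure_ball_pos volume (0 : E d) one_pos).ne'
    measure_ball_lt_top.ne).1 h1
  rw [← ENNReal.ofReal_natCast, ← ENNReal.ofReal_mul (by positivity),
    ENNReal.ofReal_le_ofReal_iff (by positivity)] at h3
  simp only [finrank_euclideanSpace, Fintype.card_fin] at h3
  have h4 : (a * Δ.meshSize) ^ d = (2 * β * a) ^ d * ρ ^ d := by
    rw [← mul_pow]; congr 1; rw [hρ]; field_simp
  rw [h4] at h3
  exact le_of_mul_le_mul_right h3 (by positivity)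

/-- The number of elements of a `1`-local basis in the vicinity of a simplex. -/
theorem QuasiUniform.card_localBasis_le [Nontrivial (E d)] {β : ℝ} (h : Δ.QuasiUniform β) {m : ℕ}
    (B : Module.Basis (Fin m) ℝ (Δ.splineSpaceZero r n)) {t : Fin m → Finset (E d)}
    (hB : ∀ ξ, tsupport (B ξ : E d → ℝ) ⊆ Δ.starRegion (t ξ) 1) (hT : T ∈ Δ.simplices)
    {I : Finset (Fin m)} (hI : ∀ ξ ∈ I, t ξ ∈ Δ.star T k) :
    (I.card : ℝ) ≤ (2 * β * (k + 2)) ^ d *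
      Module.finrank ℝ (MvPolynomial.restrictTotalDegree (Fin d) ℝ n) := by
  have hfin : (Δ.star T (k + 1)).Finite :=
    Δ.finite_simplices.subset fun S hS => mem_simplices_of_mem_star hT hS
  set 𝒯 := hfin.toFinset with h𝒯
  have hmem : ∀ S, S ∈ 𝒯 ↔ S ∈ Δ.star T (k + 1) := fun S => by simp [h𝒯]
  -- A basis function attached to `star^k(T)` lives on `star^(k+1)(T)`, whose points are within `k +
  -- 2` mesh sizes of any point of `T`.
  have hglue : ∀ ξ : I, ((B ξ : Δ.splineSpaceZero r n) : E d → ℝ) ∈ LinearMap.range (glue 𝒯 n) := by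
    intro ξ
    refine mem_range_glue _ (fun S hS => (B ξ).2.1.2.2.1 S
      (mem_simplices_of_mem_star hT ((hmem S).1 hS))) fun x hx => ?_
    by_contra hne
    obtain ⟨S, hS, hSt, hxS⟩ := mem_starRegion_one.1 (hB ξ (subset_closure hne))
    exact hx S ((hmem S).2 (mem_star_succ (hI ξ ξ.2) hS hSt)) hxS
  have hli : LinearIndependent ℝ fun ξ : I =>
      (⟨_, hglue ξ⟩ : LinearMap.range (glue 𝒯 n)) := by
    refine LinearIndependent.of_comp (Submodule.subtype _) ?_
    exact (B.linearIndependent.map' (Submodule.subtype _) (Submodule.ker_subtype _)).comp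
      ((↑) : I → Fin m) Subtype.val_injective
  have h1 := hli.fintype_card_le_finrank.trans (finrank_range_glue_le 𝒯)
  rw [Fintype.card_coe] at h1
  obtain ⟨x, hx⟩ := interior_cell_nonempty hT
  have h2 := h.card_le (h.pos hT) (meshSize_pos hT) (𝒯 := 𝒯) (x := x) (a := k + 2)
    (fun S hS => mem_simplices_of_mem_star hT ((hmem S).1 hS)) (by positivity) (fun S hS y hy => by
      have := dist_le_of_mem_star hT (interior_subset hx) ((hmem S).1 hS) hy
      rw [Metric.mem_closedBall]
      push_cast at this
      linarith)
  calc (I.card : ℝ) ≤ 𝒯.card * Module.finrank ℝ (MvPolynomial.restrictTotalDegree (Fin d) ℝ n) := by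
        exact_mod_cast h1
    _ ≤ _ := by gcongr

theorem exists_cell_of_hat_ne_zero {v x : E d} (hx : Δ.hat v x ≠ 0) :
    ∃ T ∈ Δ.simplices, v ∈ T ∧ x ∈ cell T := by
  by_cases hxd : x ∈ Δ.domain
  · obtain ⟨T, hT, hxT⟩ := mem_domain_iff.1 hxd
    rw [hat_eq_bary hT hxT] at hx
    exact ⟨T, hT, mem_of_bary_ne_zero hT hx, hxT⟩
  · exact absurd (hat_of_notMem hxd v) hx

theorem cell_subset_tsupport_hat (hT : T ∈ Δ.simplices) {v : E d} (hv : v ∈ T) :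
    cell T ⊆ tsupport (Δ.hat v) := by
  rw [← closure_interior_cell hT]
  refine closure_mono fun x hx => ?_
  rw [Function.mem_support, hat_eq_bary hT (interior_subset hx)]
  rw [interior_cell hT] at hx
  exact (hx v hv).ne'

theorem mem_enlargedSupport_of_hat_ne_zero {v x : E d} (hx : Δ.hat v x ≠ 0) :
    x ∈ Δ.enlargedSupport (Δ.hat v) := by
  obtain ⟨T, hT, hv, hxT⟩ := exists_cell_of_hat_ne_zero hx
  exact mem_iUnion₂.2 ⟨T, ⟨hT, cell_subset_tsupport_hat hT hv⟩,
    mem_starRegion_one.2 ⟨T, hT, touches_self hT, hxT⟩⟩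

/-- The hat function has values in `[0, 1]` and vanishes outside the ball of radius `η` about its
vertex. -/
theorem abs_integral_hat_mul_le {η K : ℝ} (hη : Δ.meshSize ≤ η) {v : E d} {w : E d → ℝ}
    (hw : ∀ x, |w x| ≤ K) :
    |∫ x in Δ.domain, Δ.hat v x * w x| ≤ K * volume.real (Metric.closedBall (0 : E d) η) := by
  have hzero : ∀ x ∉ Metric.closedBall v η, Δ.hat v x = 0 := by
    intro x hx
    by_contra hne
    obtain ⟨T, hT, hv, hxT⟩ := exists_cell_of_hat_ne_zero hne
    exact hx ((dist_le_meshSize hT hxT (mem_cell_of_mem hv)).trans hη)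
  rw [setIntegral_eq_integral_of_forall_compl_eq_zero fun x hx => by rw [hat_of_notMem hx, zero_mul],
    ← setIntegral_eq_integral_of_forall_compl_eq_zero (s := Metric.closedBall v η)
      fun x hx => by rw [hzero x hx, zero_mul], ← Real.norm_eq_abs]
  refine (norm_setIntegral_le_of_norm_le_const (C := K) measure_closedBall_lt_top
    fun x _ => ?_).trans_eq ?_
  · rw [Real.norm_eq_abs, abs_mul, abs_of_nonneg (hat_nonneg v x)]
    have := mul_le_mul (hat_le_one (Δ := Δ) v x) (hw x) (abs_nonneg _) zero_le_one
    linarith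
  · rw [measureReal_def, measureReal_def, Measure.addHaar_closedBall_center]

end SimplicialPartition

end GBC

/-! ### The stiffness matrix and the decay estimate -/

namespace GBC

open Filter Topology Matrix

variable {d : ℕ}

namespace SimplicialPartition

variable {Δ : SimplicialPartition d} {r n m : ℕ}
  (B : Module.Basis (Fin m) ℝ (Δ.splineSpaceZero r n))

/-- The stiffness matrix of a basis. -/
def stiffness : Matrix (Fin m) (Fin m) ℝ :=
  Matrix.of fun ξ ζ => Δ.dirichlet (B ξ : E d → ℝ) (B ζ : E d → ℝ)

theorem stiffness_isSymm : (stiffness B).IsSymm := by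
  ext ξ ζ
  exact dirichlet_comm _ _

theorem stiffness_mulVec (c : Fin m → ℝ) (ξ : Fin m) :
    (stiffness B *ᵥ c) ξ = Δ.dirichlet (B ξ : E d → ℝ) (∑ ζ, c ζ • (B ζ : E d → ℝ)) := by
  have h : (∑ ζ, c ζ • (B ζ : E d → ℝ)) = ((∑ ζ, c ζ • B ζ : Δ.splineSpaceZero r n) : E d → ℝ) := by
    push_cast; rfl
  rw [h, ← dirichletForm_apply, map_sum]
  simp only [map_smul, smul_eq_mul, mulVec, dotProduct, stiffness, of_apply]
  exact Finset.sum_congr rfl fun ζ _ => mul_comm _ _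

theorem dotProduct_stiffness_mulVec (c : Fin m → ℝ) :
    c ⬝ᵥ stiffness B *ᵥ c =
      Δ.dirichlet (∑ ζ, c ζ • (B ζ : E d → ℝ)) (∑ ζ, c ζ • (B ζ : E d → ℝ)) := by
  have h : (∑ ζ, c ζ • (B ζ : E d → ℝ)) = ((∑ ζ, c ζ • B ζ : Δ.splineSpaceZero r n) : E d → ℝ) := by
    push_cast; rfl
  simp only [dotProduct, stiffness_mulVec]
  rw [h]
  simp only [← dirichletForm_apply, map_sum, LinearMap.sum_apply, map_smul, LinearMap.smul_apply,
    smul_eq_mul]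
  refine Finset.sum_congr rfl fun ξ _ => congrArg _ (Finset.sum_congr rfl fun ζ _ => ?_)
  rw [dirichletForm_apply, dirichletForm_apply, dirichlet_comm]

variable {B}

theorem gradient_eq_zero_of_notMem_tsupport {u : E d → ℝ} {x : E d} (hx : x ∉ tsupport u) :
    gradient u x = 0 := by
  have : u =ᶠ[𝓝 x] fun _ => (0 : ℝ) := notMem_tsupport_iff_eventuallyEq.1 hx
  rw [this.gradient_eq, gradient_fun_const]

theorem exists_mem_tsupport_of_stiffness_ne_zero {ξ ζ : Fin m} (h : stiffness B ξ ζ ≠ 0) :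
    ∃ x, x ∈ tsupport (B ξ : E d → ℝ) ∧ x ∈ tsupport (B ζ : E d → ℝ) := by
  by_contra! hne
  refine h (setIntegral_eq_zero_of_forall_eq_zero fun x _ => ?_)
  by_cases hx : x ∈ tsupport (B ξ : E d → ℝ)
  · rw [gradient_eq_zero_of_notMem_tsupport (hne x hx), inner_zero_right]
  · rw [gradient_eq_zero_of_notMem_tsupport hx, inner_zero_left]

theorem exists_ne_zero_of_integral_ne_zero {f w : E d → ℝ}
    (h : ∫ x in Δ.domain, f x * w x ≠ 0) : ∃ x, f x ≠ 0 ∧ w x ≠ 0 := by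
  by_contra! hne
  refine h (setIntegral_eq_zero_of_forall_eq_zero fun x _ => ?_)
  by_cases hx : f x = 0
  · rw [hx, zero_mul]
  · rw [hne x hx, mul_zero]

theorem IsInteriorGBC.abs_le [Nontrivial (E d)] {β η K₁ C₁ C₂ q σ : ℝ} (hβ : Δ.QuasiUniform β)
    (hη : Δ.meshSize ≤ η) (hC₁ : 0 < C₁) (hC₂ : 0 < C₂) (hσ : 0 < σ) (hσ1 : σ ≤ 1)
    (hσq : σ ^ 6 = q) (hq : 1 - C₁ / C₂ ≤ q) (hB : Δ.IsLocalBasis B K₁)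
    (hS : Δ.IsStableBasis B C₁ C₂) {vᵢ : E d} (hvᵢ : vᵢ ∈ Δ.complex.vertices) {R : E d → ℝ}
    (hR : Δ.IsInteriorGBC r n (Δ.hat vᵢ) R) {T : Finset (E d)} (hT : T ∈ Δ.simplices) {v : E d}
    (hv : v ∈ cell T) {k : ℕ}
    (hk : Δ.starRegion T k ⊆ Δ.domain \ Δ.enlargedSupport (Δ.hat vᵢ)) :
    |R v| ≤ ((10 * β) ^ d * Module.finrank ℝ (MvPolynomial.restrictTotalDegree (Fin d) ℝ n) + 1) ^ 2
      * (|K₁| ^ 2 * volume.real (Metric.closedBall (0 : E d) η) / C₁) / σ ^ 2 * σ ^ k := by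
  classical
  set D := Module.finrank ℝ (MvPolynomial.restrictTotalDegree (Fin d) ℝ n)
  -- Only stars up to order `3` are counted below, and `10 = 2 * (3 + 2)`. The summand `1` gives `N
  -- ≤ N ^ 2`, so that no square root of `N` appears in the bound for the coefficients.
  set N : ℝ := (10 * β) ^ d * D + 1 with hN
  set V := volume.real (Metric.closedBall (0 : E d) η) with hV
  have hβ0 := hβ.pos hT
  have hN1 : 1 ≤ N := by
    have : 0 ≤ (10 * β) ^ d * (D : ℝ) := by positivity
    linarith
  have hV0 : 0 ≤ V := measureReal_nonneg
  have hq0 : 0 ≤ q := hσq ▸ by positivity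
  have hbd : ∀ ξ x, |(B ξ : E d → ℝ) x| ≤ |K₁| := fun ξ x => ((hB ξ).1 x).trans (le_abs_self _)
  choose t ht htB using fun ξ => (hB ξ).2
  have hcount : ∀ {S : Finset (E d)} {j : ℕ} {I : Finset (Fin m)}, S ∈ Δ.simplices → j ≤ 3 →
      (∀ ξ ∈ I, t ξ ∈ Δ.star S j) → (I.card : ℝ) ≤ N := by
    intro S j I hS hj hI
    refine (hβ.card_localBasis_le B htB hS hI).trans ?_
    have hj' : (j : ℝ) ≤ 3 := by exact_mod_cast hj
    have h2 : (2 * β * (j + 2)) ^ d ≤ (10 * β) ^ d :=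
      pow_le_pow_left₀ (by positivity) (by nlinarith) d
    have h3 : (2 * β * (j + 2)) ^ d * (D : ℝ) ≤ (10 * β) ^ d * D := by gcongr
    linarith
  set A := stiffness B with hA
  set c : Fin m → ℝ := ⇑(B.repr ⟨R, hR.1⟩) with hc
  have hRc : ∑ ζ, c ζ • (B ζ : E d → ℝ) = R := by
    have := congrArg Subtype.val (B.sum_repr ⟨R, hR.1⟩)
    refine Eq.trans ?_ this
    push_cast; rfl
  have hAc : ∀ ξ, (A *ᵥ c) ξ = -∫ x in Δ.domain, Δ.hat vᵢ x * (B ξ : E d → ℝ) x := by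
    intro ξ
    rw [hA, stiffness_mulVec, hRc, dirichlet_comm]
    exact hR.2 _ (B ξ).2
  have hsq : ∀ x : Fin m → ℝ, x ⬝ᵥ x = ∑ ξ, x ξ ^ 2 := fun x => by simp [dotProduct, pow_two]
  have hlow : ∀ x, C₁ * (x ⬝ᵥ x) ≤ x ⬝ᵥ A *ᵥ x := fun x => by
    rw [hA, dotProduct_stiffness_mulVec, hsq]; exact (hS x).1
  have hup : ∀ x, x ⬝ᵥ A *ᵥ x ≤ C₂ * (x ⬝ᵥ x) := fun x => by
    rw [hA, dotProduct_stiffness_mulVec, hsq]; exact (hS x).2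
  -- the size of the right-hand side
  obtain ⟨T₀, hT₀, hvT₀⟩ := Δ.exists_simplex_of_mem_vertices hvᵢ
  have hg : (A *ᵥ c) ⬝ᵥ (A *ᵥ c) ≤ N * (|K₁| * V) ^ 2 := by
    set I := Finset.univ.filter fun ξ => (A *ᵥ c) ξ ≠ 0 with hI
    have hcard : (I.card : ℝ) ≤ N := by
      refine hcount (j := 3) hT₀ le_rfl fun ξ hξ => ?_
      have hne := (Finset.mem_filter.1 hξ).2
      rw [hAc, neg_ne_zero] at hne
      obtain ⟨x, hx1, hx2⟩ := exists_ne_zero_of_integral_ne_zero hne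
      obtain ⟨S, hS, hvS, hxS⟩ := exists_cell_of_hat_ne_zero hx1
      refine mem_star_add_three (k := 0) rfl (ht ξ) (x := x) ?_ (htB ξ (subset_closure hx2))
      exact mem_starRegion_one.2 ⟨S, hS, ⟨vᵢ, mem_cell_of_mem hvS, mem_cell_of_mem hvT₀⟩, hxS⟩
    have hle : ∀ ξ ∈ I, (A *ᵥ c) ξ ^ 2 ≤ (|K₁| * V) ^ 2 := fun ξ _ => by
      rw [← sq_abs, hAc, abs_neg]
      have := abs_integral_hat_mul_le hη (v := vᵢ) (hbd ξ)
      gcongr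
    rw [hsq, ← Finset.sum_filter_of_ne (p := fun ξ => (A *ᵥ c) ξ ≠ 0)
      (fun ξ _ h h0 => h (by rw [h0]; simp))]
    calc _ ≤ I.card • (|K₁| * V) ^ 2 := Finset.sum_le_card_nsmul _ _ _ hle
      _ = I.card * (|K₁| * V) ^ 2 := nsmul_eq_mul _ _
      _ ≤ _ := by gcongr
  have hE : C₁ * (c ⬝ᵥ A *ᵥ c) ≤ N * (|K₁| * V) ^ 2 := (energy_le hC₁ hlow c).trans hg
  -- the decay of the coefficients
  set lev : ℕ → Set (Fin m) := fun j => {ξ | t ξ ∈ Δ.star T (2 + 3 * j)} with hlevdef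
  set M := k / 3 with hM
  -- Intersecting supports mean a distance of at most three stars, hence the step `3` in the levels.
  -- Their offset is `2` because a basis function that is nonzero at `v` is attached to a simplex of
  -- `star^2(T)`.
  have hlev : ∀ j < M, ∀ ξ ∈ lev j, ∀ ζ, A ξ ζ ≠ 0 → ζ ∈ lev (j + 1) := by
    intro j _ ξ hξ ζ h
    obtain ⟨x, hx1, hx2⟩ := exists_mem_tsupport_of_stiffness_ne_zero h
    exact mem_star_add_three hξ (ht ζ) (htB ξ hx1) (htB ζ hx2)
  -- The support of `B ξ` lies in `star^(3j+3)(T)`, and `3 * j + 3 ≤ 3 * M ≤ k`; there the hat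
  -- function vanishes.
  have hb : ∀ j < M, ∀ ξ ∈ lev j, (A *ᵥ c) ξ = 0 := by
    intro j hj ξ hξ
    by_contra hne
    rw [hAc] at hne
    obtain ⟨x, hx1, hx2⟩ := exists_ne_zero_of_integral_ne_zero (neg_ne_zero.1 hne)
    obtain ⟨S, hS, hSt, hxS⟩ := mem_starRegion_one.1 (htB ξ (subset_closure hx2))
    have h1 : S ∈ Δ.star T k :=
      star_mono hT (by omega : 2 + 3 * j + 1 ≤ k) (mem_star_succ hξ hS hSt)
    exact (hk (mem_iUnion₂.2 ⟨S, h1, hxS⟩)).2 (mem_enlargedSupport_of_hat_ne_zero hx1)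
  have hcoef : ∀ ξ ∈ lev 0, |c ξ| ≤ σ ^ (3 * M) * (N * (|K₁| * V / C₁)) := by
    intro ξ hξ
    have h1 := mul_sq_le_of_sparse (stiffness_isSymm B) hC₁ hC₂ hlow hup hq0 hq c lev M hlev hb hξ
    refine abs_le_of_sq_le_sq ?_ (by positivity)
    refine le_of_mul_le_mul_left ?_ (by positivity : 0 < C₁ * C₁)
    calc C₁ * C₁ * c ξ ^ 2 = C₁ * (C₁ * c ξ ^ 2) := by ring
      _ ≤ C₁ * (q ^ M * (c ⬝ᵥ A *ᵥ c)) := by gcongr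
      _ = q ^ M * (C₁ * (c ⬝ᵥ A *ᵥ c)) := by ring
      _ ≤ q ^ M * (N * (|K₁| * V) ^ 2) := by gcongr
      _ ≤ q ^ M * (N ^ 2 * (|K₁| * V) ^ 2) := by
          gcongr
          nlinarith
      _ = C₁ * C₁ * (σ ^ (3 * M) * (N * (|K₁| * V / C₁))) ^ 2 := by
          rw [← hσq, ← pow_mul, show 6 * M = 3 * M + 3 * M by ring, pow_add]
          field_simp
  -- the value at the point
  set J := Finset.univ.filter fun ξ => (B ξ : E d → ℝ) v ≠ 0 with hJ
  have hJlev : ∀ ξ ∈ J, ξ ∈ lev 0 := by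
    intro ξ hξ
    obtain ⟨S, hS, hSt, hvS⟩ :=
      mem_starRegion_one.1 (htB ξ (subset_closure (Finset.mem_filter.1 hξ).2))
    have h1 : S ∈ Δ.star T 1 := mem_star_succ (k := 0) rfl hS ⟨v, hvS, hv⟩
    exact mem_star_succ h1 (ht ξ) hSt.symm
  have hJcard : (J.card : ℝ) ≤ N := hcount (j := 2) hT (by norm_num) hJlev
  have hval : |R v| ≤ N * (σ ^ (3 * M) * (N * (|K₁| * V / C₁)) * |K₁|) := by
    have h1 : R v = ∑ ξ ∈ J, c ξ * (B ξ : E d → ℝ) v := by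
      conv_lhs => rw [← hRc]
      rw [Finset.sum_apply, Finset.sum_filter_of_ne fun ξ _ h => right_ne_zero_of_mul h]
      rfl
    rw [h1]
    calc _ ≤ ∑ ξ ∈ J, |c ξ * (B ξ : E d → ℝ) v| := Finset.abs_sum_le_sum_abs _ _
      _ ≤ J.card • (σ ^ (3 * M) * (N * (|K₁| * V / C₁)) * |K₁|) := by
          refine Finset.sum_le_card_nsmul _ _ _ fun ξ hξ => ?_
          rw [abs_mul]
          exact mul_le_mul (hcoef ξ (hJlev ξ hξ)) (hbd ξ v) (abs_nonneg _) (by positivity)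
      _ = J.card * (σ ^ (3 * M) * (N * (|K₁| * V / C₁)) * |K₁|) := nsmul_eq_mul _ _
      _ ≤ _ := by gcongr
  -- Rounding `k / 3` down loses at most two factors `σ`.
  have hpow : σ ^ (3 * M) ≤ σ ^ k / σ ^ 2 := by
    rw [le_div_iff₀ (by positivity), ← pow_add]
    exact pow_le_pow_of_le_one hσ.le hσ1 (by omega)
  calc |R v| ≤ N * (σ ^ (3 * M) * (N * (|K₁| * V / C₁)) * |K₁|) := hval
    _ ≤ N * (σ ^ k / σ ^ 2 * (N * (|K₁| * V / C₁)) * |K₁|) := by gcongr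
    _ = _ := by field_simp

end SimplicialPartition

/-- The contraction factor `1 - C₁ / C₂` is bounded through `κ` alone, which fixes `σ` before all
other data; everything else enters only `K`. -/
theorem exists_decay_constants (κ : ℝ) : ∃ σ : ℝ, 0 < σ ∧ σ < 1 ∧
      ∀ (d r n : ℕ) (β η K₁ C₁ C₂ : ℝ), 2 ≤ d → 1 ≤ n → 0 < C₁ → 0 < C₂ → C₂ / C₁ ≤ κ →
        ∃ K : ℝ, 0 < K ∧
          ∀ (Δ : GBC.SimplicialPartition d), Δ.QuasiUniform β → Δ.meshSize ≤ η →
            ∀ (m : ℕ) (B : Module.Basis (Fin m) ℝ (Δ.splineSpaceZero r n)),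
              Δ.IsLocalBasis B K₁ → Δ.IsStableBasis B C₁ C₂ →
              ∀ vᵢ ∈ Δ.interiorVertices, ∀ h R : GBC.E d → ℝ,
                Δ.IsHat vᵢ h → Δ.IsInteriorGBC r n h R →
                ∀ v ∈ Δ.domain, v ∉ Δ.enlargedSupport h →
                  ∀ T ∈ Δ.simplices, v ∈ GBC.cell T →
                    ∀ k L : ℕ, 1 ≤ k →
                      Δ.starRegion T k ⊆ Δ.domain \ Δ.enlargedSupport h →
                      Δ.IsSimplicesAway T L →
                      |R v| ≤ K * (L + 1) * σ ^ k := by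
  -- The maximum with `2` keeps `q` in `[1/2, 1)` for every real `κ`.
  set κ' := max κ 2 with hκ'
  have hκ2 : 2 ≤ κ' := le_max_right _ _
  set q : ℝ := 1 - 1 / κ' with hq
  have hκi : 1 / κ' ≤ 1 / 2 := one_div_le_one_div_of_le two_pos hκ2
  have hq0 : 0 < q := by linarith
  have hq1 : q < 1 := by
    have : 0 < 1 / κ' := by positivity
    linarith
  -- The sixth root: the energy gains a factor `q` per three stars, and coefficients are of the
  -- order of the square root of the energy.
  have hσ0 : 0 < q ^ ((6 : ℕ) : ℝ)⁻¹ := Real.rpow_pos_of_pos hq0 _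
  have hσ1 : q ^ ((6 : ℕ) : ℝ)⁻¹ < 1 := Real.rpow_lt_one hq0.le hq1 (by positivity)
  have hσq : (q ^ ((6 : ℕ) : ℝ)⁻¹) ^ 6 = q := Real.rpow_inv_natCast_pow hq0.le (by norm_num)
  set σ := q ^ ((6 : ℕ) : ℝ)⁻¹
  refine ⟨σ, hσ0, hσ1, fun d r n β η K₁ C₁ C₂ hd _ hC₁ hC₂ hC => ?_⟩
  have : Nonempty (Fin d) := ⟨⟨0, by omega⟩⟩
  have hqC : 1 - C₁ / C₂ ≤ q := by
    have h1 : 1 / κ' ≤ 1 / (C₂ / C₁) :=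
      one_div_le_one_div_of_le (by positivity) (hC.trans (le_max_left _ _))
    rw [one_div_div] at h1
    linarith
  set K := ((10 * β) ^ d * Module.finrank ℝ (MvPolynomial.restrictTotalDegree (Fin d) ℝ n) + 1) ^ 2
      * (|K₁| ^ 2 * volume.real (Metric.closedBall (0 : E d) η) / C₁) / σ ^ 2
  have hK : 0 ≤ K := by positivity
  refine ⟨K + 1, by positivity, fun Δ hβ hη m B hB hS vᵢ hvᵢ h R hh hR v _ _ T hT hv k L _ hk _ => ?_⟩
  obtain rfl := hh.eq_hat
  refine (hR.abs_le hβ hη hC₁ hC₂ hσ0 hσ1.le hσq hqC hB hS hvᵢ.1 hT hv hk).trans ?_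
  gcongr ?_ * _
  have : (0 : ℝ) ≤ L := L.cast_nonneg
  nlinarith

end GBC

/-! ### A stable local basis of the continuous splines -/

namespace GBC

open Filter Topology Matrix

variable {d : ℕ}

/-- Homogenization of a polynomial of degree at most `n`, with polynomials of degree at most `1`
substituted for the variables and for the homogenizing variable. -/
theorem exists_homogenization {σ : Type*} [Fintype σ] {n : ℕ} (p : MvPolynomial σ ℝ)
    (hp : p.totalDegree ≤ n) (Y : σ → MvPolynomial σ ℝ) (hY : ∀ i, (Y i).totalDegree ≤ 1)
    (s : MvPolynomial σ ℝ) (hs : s.totalDegree ≤ 1) :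
    ∃ Q : MvPolynomial σ ℝ, Q.totalDegree ≤ n ∧ ∀ x : σ → ℝ,
      (MvPolynomial.eval x s ≠ 0 → MvPolynomial.eval x Q = MvPolynomial.eval x s ^ n *
        MvPolynomial.eval (fun i => (MvPolynomial.eval x s)⁻¹ * MvPolynomial.eval x (Y i)) p) ∧
      (1 ≤ n → MvPolynomial.eval x s = 0 → (∀ i, MvPolynomial.eval x (Y i) = 0) →
        MvPolynomial.eval x Q = 0) := by
  have hdeg : ∀ m ∈ p.support, ∑ i, m i ≤ n := fun m hm => by
    have := (MvPolynomial.le_totalDegree hm).trans hp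
    rwa [Finsupp.sum_fintype _ _ fun _ => rfl] at this
  -- `Q = s ^ n * p (Y / s)` with denominators cleared: each monomial is padded by powers of `s` to
  -- degree `n`. If `n ≥ 1`, every term keeps a factor `s` or `Y i`, so it vanishes where all of
  -- these do.
  refine ⟨∑ m ∈ p.support, MvPolynomial.C (p.coeff m) * (∏ i, Y i ^ m i) * s ^ (n - ∑ i, m i),
    ?_, fun x => ⟨fun h => ?_, fun hn h h' => ?_⟩⟩
  · refine MvPolynomial.totalDegree_finsetSum_le fun m hm => ?_
    refine (MvPolynomial.totalDegree_mul _ _).trans ?_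
    have h1 : (MvPolynomial.C (p.coeff m) * ∏ i, Y i ^ m i).totalDegree ≤ ∑ i, m i := by
      refine (MvPolynomial.totalDegree_mul _ _).trans ?_
      rw [MvPolynomial.totalDegree_C, zero_add]
      refine (MvPolynomial.totalDegree_finsetProd _ _).trans (Finset.sum_le_sum fun i _ => ?_)
      exact (MvPolynomial.totalDegree_pow _ _).trans (by nlinarith [hY i])
    have h2 : (s ^ (n - ∑ i, m i)).totalDegree ≤ n - ∑ i, m i :=
      (MvPolynomial.totalDegree_pow _ _).trans (by nlinarith)
    have := hdeg m hm
    omega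
  · rw [MvPolynomial.eval_eq' _ p, Finset.mul_sum, map_sum]
    refine Finset.sum_congr rfl fun m hm => ?_
    simp only [map_mul, MvPolynomial.eval_C, map_prod, map_pow, mul_pow, Finset.prod_mul_distrib,
      Finset.prod_pow_eq_pow_sum]
    rw [pow_sub₀ _ h (hdeg m hm), inv_pow]
    ring
  · rw [map_sum]
    refine Finset.sum_eq_zero fun m _ => ?_
    simp only [map_mul, map_prod, map_pow, h, h', Finset.prod_pow_eq_pow_sum]
    by_cases hm : ∑ i, m i = 0
    · rw [hm, Nat.sub_zero, zero_pow (by omega : n ≠ 0), mul_zero]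
    · rw [zero_pow hm, mul_zero, zero_mul]

namespace SimplicialPartition

variable {Δ : SimplicialPartition d} {n : ℕ}

/-- The homogeneous extension, of degree `n`, of the values of `u` on the subcomplex spanned by
a set `A` of vertices. -/
def homogExt (Δ : SimplicialPartition d) (n : ℕ) (A : Finset (E d)) (u : E d → ℝ) (x : E d) : ℝ :=
  (∑ v ∈ A, Δ.hat v x) ^ n * u ((∑ v ∈ A, Δ.hat v x)⁻¹ • ∑ v ∈ A, Δ.hat v x • v)

section

variable {T : Finset (E d)} {x : E d}

theorem sum_hat_smul {F : Type*} [AddCommGroup F] [Module ℝ F] [DecidableEq (E d)]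
    (hT : T ∈ Δ.simplices) (hx : x ∈ cell T) (A : Finset (E d)) (f : E d → F) :
    ∑ v ∈ A, Δ.hat v x • f v = ∑ v ∈ A ∩ T, Δ.bary T v x • f v := by
  rw [← Finset.filter_mem_eq_inter, Finset.sum_filter_of_ne]
  · exact Finset.sum_congr rfl fun v _ => by rw [hat_eq_bary hT hx]
  · intro v _ h
    exact mem_of_bary_ne_zero hT (x := x) fun h0 => h (by rw [h0, zero_smul])

theorem sum_hat [DecidableEq (E d)] (hT : T ∈ Δ.simplices) (hx : x ∈ cell T)
    (A : Finset (E d)) : ∑ v ∈ A, Δ.hat v x = ∑ v ∈ A ∩ T, Δ.bary T v x := by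
  simpa using sum_hat_smul hT hx A fun _ => (1 : ℝ)

end

theorem homogExt_of_notMem (hn : 1 ≤ n) (A : Finset (E d)) (u : E d → ℝ) {x : E d}
    (hx : x ∉ Δ.domain) : Δ.homogExt n A u x = 0 := by
  rw [homogExt, Finset.sum_eq_zero fun v _ => hat_of_notMem hx v, zero_pow (by omega), zero_mul]

/-- On each simplex the extension is a homogenized polynomial of degree at most `n`. The point where
`u` is evaluated lies in the face carrying `x`, so `mem_frontier_of_bary` passes the zero boundary
values on. -/
theorem homogExt_mem (hn : 1 ≤ n) (A : Finset (E d)) {u : E d → ℝ}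
    (hu : u ∈ Δ.splineSpaceZero 0 n) : Δ.homogExt n A u ∈ Δ.splineSpaceZero 0 n := by
  classical
  have hproj : ∀ T ∈ Δ.simplices, ∀ x ∈ cell T, ∑ v ∈ A, Δ.hat v x ≠ 0 →
      (∑ v ∈ A, Δ.hat v x)⁻¹ • ∑ v ∈ A, Δ.hat v x • v ∈ cell T ∧
      ∀ w, Δ.bary T w ((∑ v ∈ A, Δ.hat v x)⁻¹ • ∑ v ∈ A, Δ.hat v x • v) ≠ 0 →
        Δ.bary T w x ≠ 0 := by
    intro T hT x hx hS
    rw [sum_hat hT hx, sum_hat_smul hT hx A fun v => v] at *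
    set S := ∑ v ∈ A ∩ T, Δ.bary T v x
    have hw : ∑ v ∈ A ∩ T, S⁻¹ * Δ.bary T v x = 1 := by
      rw [← Finset.mul_sum, inv_mul_cancel₀ hS]
    have hS0 : 0 ≤ S := Finset.sum_nonneg fun v _ => bary_nonneg hT hx v
    rw [Finset.smul_sum]
    simp only [smul_smul]
    refine ⟨convexHull_mono (by exact_mod_cast Finset.inter_subset_right) (mem_cell_iff.2
      ⟨fun v => S⁻¹ * Δ.bary T v x, fun v _ => mul_nonneg (inv_nonneg.2 hS0) (bary_nonneg hT hx v),
        hw, rfl⟩), fun w hne => ?_⟩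
    by_cases hwA : w ∈ A ∩ T
    · rw [bary_combination_of_mem hT Finset.inter_subset_right hw hwA] at hne
      exact right_ne_zero_of_mul hne
    · exact absurd (bary_combination_of_notMem hT Finset.inter_subset_right hw hwA) hne
  refine ⟨mem_splineSpace_zero (fun T hT => ?_) fun x hx => homogExt_of_notMem hn A u hx,
    fun x hx => ?_⟩
  · obtain ⟨p, hp, hpu⟩ := hu.1.2.2.1 T hT
    -- `s` is the sum of the coordinates of the vertices in `A`, and `Y i` is the `i`-th component
    -- of the corresponding weighted sum of vertices.
    obtain ⟨s, hs, hse⟩ := exists_eval_eq_affineMap (∑ v ∈ A ∩ T, Δ.bary T v)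
    have hY : ∀ i, ∃ Y : MvPolynomial (Fin d) ℝ, Y.totalDegree ≤ 1 ∧ ∀ x : E d,
        MvPolynomial.eval (fun i => x i) Y = (∑ v ∈ A ∩ T, v i • Δ.bary T v : E d →ᵃ[ℝ] ℝ) x :=
      fun i => exists_eval_eq_affineMap _
    choose Y hY hYe using hY
    obtain ⟨Q, hQ, hQe⟩ := exists_homogenization p hp Y hY s hs
    refine ⟨Q, hQ, fun x hx => ?_⟩
    obtain ⟨h1, h2⟩ := hQe fun i => x i
    have hsum : ∀ (t : Finset (E d)) (f : E d → (E d →ᵃ[ℝ] ℝ)),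
        (∑ v ∈ t, f v : E d →ᵃ[ℝ] ℝ) x = ∑ v ∈ t, f v x := by
      intro t f
      induction t using Finset.induction_on with
      | empty => simp
      | insert v t hv ih => simp [Finset.sum_insert hv, ih]
    have hs' : MvPolynomial.eval (fun i => x i) s = ∑ v ∈ A, Δ.hat v x := by
      rw [hse, hsum, sum_hat hT hx]
    have hY' : ∀ i, MvPolynomial.eval (fun i => x i) (Y i) = (∑ v ∈ A, Δ.hat v x • v) i := by
      intro i
      rw [hYe, hsum, sum_hat_smul hT hx A fun v => v]
      simp [mul_comm]
    by_cases hS : ∑ v ∈ A, Δ.hat v x = 0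
    · rw [homogExt, hS, zero_pow (by omega), zero_mul]
      refine (h2 hn (by rw [hs', hS]) fun i => ?_).symm
      have h0 := (Finset.sum_eq_zero_iff_of_nonneg fun v _ => hat_nonneg v x).1 hS
      rw [hY', Finset.sum_eq_zero fun v hv => by rw [h0 v hv, zero_smul]]
      rfl
    · rw [h1 (by rwa [hs']), homogExt, hpu _ (hproj T hT x hx hS).1]
      simp only [hs', hY']
      rfl
  · have hxd : x ∈ Δ.domain := Δ.isCompact_domain.isClosed.frontier_subset hx
    obtain ⟨T, hT, hxT⟩ := mem_domain_iff.1 hxd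
    by_cases hS : ∑ v ∈ A, Δ.hat v x = 0
    · rw [homogExt, hS, zero_pow (by omega), zero_mul]
    · obtain ⟨h1, h2⟩ := hproj T hT x hxT hS
      rw [homogExt, hu.2 _ (mem_frontier_of_bary hT hxT h1 hx h2), mul_zero]

/-- With all vertices in `A` the coordinates sum to `1` on the domain and reproduce the point. -/
theorem exists_homogExt_eq (hn : 1 ≤ n) : ∃ A : Finset (E d), ∀ u ∈ Δ.splineSpaceZero 0 n,
    Δ.homogExt n A u = u := by
  classical
  refine ⟨Δ.finite_simplices.toFinset.biUnion id, fun u hu => funext fun x => ?_⟩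
  by_cases hx : x ∈ Δ.domain
  · obtain ⟨T, hT, hxT⟩ := mem_domain_iff.1 hx
    have hsub : Δ.finite_simplices.toFinset.biUnion id ∩ T = T :=
      Finset.inter_eq_right.2 fun v hv =>
        Finset.mem_biUnion.2 ⟨T, Δ.finite_simplices.mem_toFinset.2 hT, hv⟩
    rw [homogExt, sum_hat hT hxT, sum_hat_smul hT hxT _ fun v => v, hsub, sum_bary hT,
      sum_bary_smul hT]
    simp
  · rw [homogExt_of_notMem hn _ _ hx, hu.1.2.2.2 x hx]

variable (Δ n) in
/-- The splines with zero boundary values that are bounded by `1` and supported in the star of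
a simplex. -/
def localSplines : Set (Δ.splineSpaceZero 0 n) :=
  {w | (∀ x, |(w : E d → ℝ) x| ≤ 1) ∧
    ∃ T ∈ Δ.simplices, tsupport (w : E d → ℝ) ⊆ Δ.starRegion T 1}

theorem isClosed_starRegion_one (T : Finset (E d)) : IsClosed (Δ.starRegion T 1) := by
  have : (Δ.star T 1).Finite := Δ.finite_simplices.subset fun S hS => hS.1
  exact this.isClosed_biUnion fun S _ => (isCompact_cell S).isClosed

theorem exists_bound {r : ℕ} {u : E d → ℝ} (hu : u ∈ Δ.splineSpaceZero r n) :
    ∃ M, 0 < M ∧ ∀ x, |u x| ≤ M := by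
  obtain ⟨M, hM⟩ := Δ.isCompact_domain.exists_bound_of_continuousOn hu.1.1
  refine ⟨|M| + 1, by positivity, fun x => ?_⟩
  by_cases hx : x ∈ Δ.domain
  · have := hM x hx
    rw [Real.norm_eq_abs] at this
    linarith [le_abs_self M]
  · rw [hu.1.2.2.2 x hx, abs_zero]; positivity

/-- The star of the vertex `v` lies in the first star of any simplex at `v`; dividing by a bound for
`w` makes it a local spline. -/
theorem mem_span_localSplines {w : Δ.splineSpaceZero 0 n} {v : E d}
    (hw : ∀ x, Δ.hat v x = 0 → (w : E d → ℝ) x = 0) :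
    w ∈ Submodule.span ℝ (Δ.localSplines n) := by
  by_cases hv : ∃ T ∈ Δ.simplices, v ∈ T
  · obtain ⟨T, hT, hvT⟩ := hv
    have hsub : tsupport (w : E d → ℝ) ⊆ Δ.starRegion T 1 := by
      refine closure_minimal (fun x hx => ?_) (isClosed_starRegion_one T)
      obtain ⟨S, hS, hvS, hxS⟩ := exists_cell_of_hat_ne_zero fun h => hx (hw x h)
      exact mem_starRegion_one.2 ⟨S, hS, ⟨v, mem_cell_of_mem hvS, mem_cell_of_mem hvT⟩, hxS⟩
    obtain ⟨M, hM, hMw⟩ := exists_bound w.2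
    have hmem : M⁻¹ • w ∈ Δ.localSplines n := by
      refine ⟨fun x => ?_, T, hT, ?_⟩
      · change |M⁻¹ * (w : E d → ℝ) x| ≤ 1
        rw [abs_mul, abs_of_pos (inv_pos.2 hM), inv_mul_le_iff₀ hM, mul_one]
        exact hMw x
      · refine (closure_mono fun x hx => ?_).trans hsub
        exact right_ne_zero_of_mul (a := M⁻¹) hx
    rw [show w = M • M⁻¹ • w by rw [smul_smul, mul_inv_cancel₀ hM.ne', one_smul]]
    exact Submodule.smul_mem _ _ (Submodule.subset_span hmem)
  · have : w = 0 := by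
      refine Subtype.ext (funext fun x => hw x ?_)
      by_contra h
      obtain ⟨T, hT, hvT, -⟩ := exists_cell_of_hat_ne_zero h
      exact hv ⟨T, hT, hvT⟩
    rw [this]
    exact Submodule.zero_mem _

/-- Induction on `A`: where the hat function of `v` vanishes, inserting `v` into `A` does not change
`homogExt`, so each increment lives on the star of `v`. The empty set gives zero because `n ≥ 1`. -/
theorem span_localSplines (hn : 1 ≤ n) : Submodule.span ℝ (Δ.localSplines n) = ⊤ := by
  classical
  rw [eq_top_iff]
  rintro ⟨u, hu⟩ -
  have key : ∀ A : Finset (E d),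
      (⟨_, homogExt_mem hn A hu⟩ : Δ.splineSpaceZero 0 n) ∈
        Submodule.span ℝ (Δ.localSplines n) := by
    intro A
    induction A using Finset.induction_on with
    | empty =>
      convert Submodule.zero_mem _
      ext x
      simp [homogExt, zero_pow (by omega : n ≠ 0)]
    | insert v A hv ih =>
      rw [← sub_add_cancel (⟨_, homogExt_mem hn (insert v A) hu⟩ : Δ.splineSpaceZero 0 n)
        ⟨_, homogExt_mem hn A hu⟩]
      refine Submodule.add_mem _ (mem_span_localSplines (v := v) fun x hx => ?_) ih
      change Δ.homogExt n (insert v A) u x - Δ.homogExt n A u x = 0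
      simp [homogExt, Finset.sum_insert hv, hx]
  obtain ⟨A, hA⟩ := exists_homogExt_eq (Δ := Δ) hn
  convert key A
  exact (hA u hu).symm

theorem exists_isLocalBasis (hn : 1 ≤ n) :
    ∃ (m : ℕ) (B : Module.Basis (Fin m) ℝ (Δ.splineSpaceZero 0 n)), Δ.IsLocalBasis B 1 := by
  have := Δ.finiteDimensional_splineSpaceZero 0 n
  have hspan := (span_localSplines (Δ := Δ) hn).ge
  let B := Module.Basis.ofSpan hspan
  have : Fintype ((linearIndepOn_empty ℝ (id : Δ.splineSpaceZero 0 n → _)).extend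
      (empty_subset (Δ.localSplines n))) := FiniteDimensional.fintypeBasisIndex B
  refine ⟨_, B.reindex (Fintype.equivFin _), fun ξ => ?_⟩
  rw [Module.Basis.reindex_apply]
  exact Module.Basis.ofSpan_subset hspan ⟨_, rfl⟩

/-- Every basis is stable, with constants that depend on everything. -/
theorem exists_isStableBasis [Nontrivial (E d)] {r m : ℕ}
    (B : Module.Basis (Fin m) ℝ (Δ.splineSpaceZero r n)) :
    ∃ C₁ C₂ : ℝ, 0 < C₁ ∧ 0 < C₂ ∧ Δ.IsStableBasis B C₁ C₂ := by
  let f : E m → ℝ := fun c => (fun i => c i) ⬝ᵥ stiffness B *ᵥ fun i => c i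
  have hf : Continuous f := by
    simp only [f, dotProduct, mulVec]
    fun_prop
  have hpos : ∀ c ∈ Metric.sphere (0 : E m) 1, 0 < f c := by
    intro c hc
    have hc0 : c ≠ 0 := by
      rintro rfl
      simp at hc
    have hfc : f c = Δ.dirichlet (∑ ζ, c ζ • (B ζ : E d → ℝ)) (∑ ζ, c ζ • (B ζ : E d → ℝ)) :=
      dotProduct_stiffness_mulVec B _
    rw [hfc]
    refine (dirichlet_self_nonneg _).lt_of_ne' fun h => hc0 ?_
    have hmem : (∑ ζ, c ζ • (B ζ : E d → ℝ)) ∈ Δ.splineSpaceZero r n :=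
      Submodule.sum_mem _ fun ζ _ => Submodule.smul_mem _ _ (B ζ).2
    have h0 : ∑ ζ, c ζ • B ζ = 0 := by
      apply Subtype.ext
      have := eq_zero_of_dirichlet_self_eq_zero hmem h
      push_cast
      exact this
    ext i
    exact Fintype.linearIndependent_iff.1 B.linearIndependent _ h0 i
  obtain ⟨C₁, hC₁, h₁⟩ := (isCompact_sphere (0 : E m) 1).exists_forall_le' hf.continuousOn hpos
  obtain ⟨C₂, h₂⟩ := (isCompact_sphere (0 : E m) 1).bddAbove_image hf.continuousOn
  -- The maximum with `1` makes the upper constant positive even when `m = 0` and the sphere is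
  -- empty.
  refine ⟨C₁, max C₂ 1, hC₁, by positivity, fun c => ?_⟩
  rw [← dotProduct_stiffness_mulVec]
  set c' : E m := WithLp.toLp 2 c with hc'
  have hnorm : ∑ ξ, c ξ ^ 2 = ‖c'‖ ^ 2 := by
    rw [EuclideanSpace.norm_sq_eq]; simp [hc']
  rw [hnorm]
  by_cases h0 : c' = 0
  · have : c = 0 := by
      ext i
      exact congrArg (fun y : E m => y i) h0
    simp [this, h0]
  · have hs : ‖c'‖⁻¹ • c' ∈ Metric.sphere (0 : E m) 1 := by
      simp [norm_smul, h0]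
    have hscale : c ⬝ᵥ stiffness B *ᵥ c = ‖c'‖ ^ 2 * f (‖c'‖⁻¹ • c') := by
      have : (fun i => (‖c'‖⁻¹ • c') i) = ‖c'‖⁻¹ • c := by ext i; simp [hc']
      simp only [f, this, mulVec_smul, smul_dotProduct, dotProduct_smul, smul_eq_mul]
      have := norm_ne_zero_iff.2 h0
      field_simp
    have hle := h₂ ⟨_, hs, rfl⟩
    rw [hscale, mul_comm C₁, mul_comm (max C₂ 1)]
    exact ⟨by gcongr; exact h₁ _ hs, by gcongr; exact hle.trans (le_max_left _ _)⟩

end SimplicialPartition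

end GBC

end

theorem mainTheorem3 :
    -- the hat functions and the discrete interior GBC functions exist and are unique
    (∀ (d : ℕ), 2 ≤ d → ∀ (Δ : GBC.SimplicialPartition d), ∀ v ∈ Δ.interiorVertices,
      (∃! h, Δ.IsHat v h) ∧
      ∀ (r n : ℕ), 1 ≤ n → ∀ h, Δ.IsHat v h → ∃! R, Δ.IsInteriorGBC r n h R) ∧
    -- continuous splines always have a stable 1-local basis
    (∀ (d n : ℕ), 2 ≤ d → 1 ≤ n → ∀ (Δ : GBC.SimplicialPartition d),
      ∃ (m : ℕ) (B : Module.Basis (Fin m) ℝ (Δ.splineSpaceZero 0 n)) (C₁ C₂ : ℝ),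
        0 < C₁ ∧ 0 < C₂ ∧ Δ.IsLocalBasis B 1 ∧ Δ.IsStableBasis B C₁ C₂) ∧
    -- the decay estimate: `σ` depends only on (a bound `κ` of) the ratio `C₂ / C₁`
    ∀ κ : ℝ, ∃ σ : ℝ, 0 < σ ∧ σ < 1 ∧
      ∀ (d r n : ℕ) (β η K₁ C₁ C₂ : ℝ), 2 ≤ d → 1 ≤ n → 0 < C₁ → 0 < C₂ → C₂ / C₁ ≤ κ →
        ∃ K : ℝ, 0 < K ∧
          ∀ (Δ : GBC.SimplicialPartition d), Δ.QuasiUniform β → Δ.meshSize ≤ η →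
            ∀ (m : ℕ) (B : Module.Basis (Fin m) ℝ (Δ.splineSpaceZero r n)),
              Δ.IsLocalBasis B K₁ → Δ.IsStableBasis B C₁ C₂ →
              ∀ vᵢ ∈ Δ.interiorVertices, ∀ h R : GBC.E d → ℝ,
                Δ.IsHat vᵢ h → Δ.IsInteriorGBC r n h R →
                ∀ v ∈ Δ.domain, v ∉ Δ.enlargedSupport h →
                  ∀ T ∈ Δ.simplices, v ∈ GBC.cell T →
                    ∀ k L : ℕ, 1 ≤ k →
                      Δ.starRegion T k ⊆ Δ.domain \ Δ.enlargedSupport h →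
                      Δ.IsSimplicesAway T L →
                      |R v| ≤ K * (L + 1) * σ ^ k := by
  refine ⟨fun d hd Δ v hv => ?_, fun d n hd hn Δ => ?_, GBC.exists_decay_constants⟩
  · have : Nonempty (Fin d) := ⟨⟨0, by omega⟩⟩
    exact ⟨⟨_, GBC.SimplicialPartition.isHat_hat hv.1, fun _ h => h.eq_hat⟩,
      fun _ _ _ _ hh => GBC.SimplicialPartition.existsUnique_isInteriorGBC hh.1.1⟩
  · have : Nonempty (Fin d) := ⟨⟨0, by omega⟩⟩
    obtain ⟨m, B, hB⟩ := GBC.SimplicialPartition.exists_isLocalBasis (Δ := Δ) hn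
    obtain ⟨C₁, C₂, h₁, h₂, hS⟩ := GBC.SimplicialPartition.exists_isStableBasis B
    exact ⟨m, B, C₁, C₂, h₁, h₂, hB, hS⟩
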